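/- Fix an integer $D\ge 1$ (independent of $N$), a real number $0<\lambda<1$, a probability law $\nu$ on $(0,\infty)$ (the service time distribution) and a work-conserving local service discipline for a unit-speed server (a rule, possibly randomised, that is non-anticipating with respect to arrivals and that splits the capacity of the server among the tasks present at it, so that it works at full speed whenever there is unfinished work). For $N\ge D$, $N\geq 1$, consider the system of $N$ parallel servers, all using this discipline, with JSQ($D$) allocation: tasks arrive at a dispatcher as a Poisson process of rate $\lambda N$, with i.i.d. service requirements of law $\nu$; for every arriving task a set of $D$ distinct servers is sampled uniformly at random, and the task immediately joins the one with the shortest queue among them, ties being broken uniformly at random. The system starts from a deterministic configuration $\xi\in\mathbb Z_+^N$, with $\xi(i)$ tasks at server $i$ at time $0$; the remaining service requirements of these tasks are positive, with an arbitrary law at each server and independent across servers. The arrival times, samples, tie-breaking choices, service requirements of the arriving tasks, remaining requirements of the initial tasks at each server, and internal randomisations of the servers are independent. Let $X^N_t(i)$ be the number of tasks at server $i$ at time $t$, and let $$m^N_k(t)=\frac1N\,\#\{i\in\{1,\dots,N\}: X^N_t(i)=k\},\qquad k\in\mathbb Z_+ .$$ Then for every $t\ge 0$ and all $k,l\in\mathbb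 Z_+$ there exists $N_0\geq D$ such that for all $N\ge N_0$ $$\sup_{\xi\in\mathbb Z_+^N}\Big|\mathbb E_\xi\big[m^N_k(t)\,m^N_l(t)\big]-\mathbb E_\xi\big[m^N_k(t)\big]\,\mathbb E_\xi\big[m^N_l(t)\big]\Big|\;\le\;\frac{1+(3/2)^D\big(e^{2^D\lambda D t}-1\big)}{N},$$ and $N_0$ depends neither on $\xi$ nor on the laws of the remaining service requirements of the initial tasks. -/

import Mathlib

open MeasureTheory ProbabilityTheory

namespace PowerOfD

/-! ### Service disciplines of a single server -/

/-- A finite record of the tasks sent to one server: the list of pairs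
`(arrival time, service requirement)`, in order of arrival. -/
abbrev History := List (ℝ × ℝ)

/-- Histories that make sense: nonnegative arrival times, listed in nondecreasing order, and
positive service requirements. -/
def History.Admissible (h : History) : Prop :=
  h.Pairwise (fun p q => p.1 ≤ q.1) ∧ ∀ p ∈ h, 0 ≤ p.1 ∧ 0 < p.2

/-- A (local, possibly randomised) work-conserving service discipline for a server of unit speed.

`served u h t j` is the amount of service that task number `j` of the history `h` has received up
to time `t`, when the internal randomness of the server takes the value `u`. How the
server splits its capacity among the tasks present is arbitrary (FIFO, LIFO, processor sharing,
shortest remaining time, random order, ...), subject to the laws below. -/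
structure ServiceDiscipline where
  served : ℝ → History → ℝ → ℕ → ℝ
  measurable_served : ∀ n j : ℕ,
    Measurable fun p : ℝ × (Fin n → ℝ × ℝ) × ℝ => served p.1 (List.ofFn p.2.1) p.2.2 j
  /-- A task receives no service before it arrives. -/
  served_before : ∀ (u : ℝ) (h : History), h.Admissible → ∀ (j : ℕ) (hj : j < h.length) (t : ℝ),
    t ≤ (h[j]).1 → served u h t j = 0
  /-- Service received is never lost. -/
  served_mono : ∀ (u : ℝ) (h : History), h.Admissible → ∀ j < h.length,
    Monotone fun t => served u h t j
  /-- A task never receives more service than it requires. -/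
  served_le : ∀ (u : ℝ) (h : History), h.Admissible → ∀ (j : ℕ) (hj : j < h.length) (t : ℝ),
    served u h t j ≤ (h[j]).2
  /-- The service given up to time `t` does not depend on arrivals at time `t` or later. -/
  causal : ∀ (u : ℝ) (h : History) (a s : ℝ), History.Admissible (h ++ [(a, s)]) →
    ∀ j < h.length, ∀ t ≤ a, served u (h ++ [(a, s)]) t j = served u h t j
  /-- The server works at unit speed as long as there is unfinished work: during a time interval
  `[r, t]` without new arrivals, the total service given is the minimum of `t - r` and the work
  that is unfinished at time `r`. -/
  work_conserving : ∀ (u : ℝ) (h : History), h.Admissible → ∀ r t : ℝ,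
    (∀ p ∈ h, p.1 ≤ r) → r ≤ t →
    ∑ j : Fin h.length, (served u h t j - served u h r j) =
      min (t - r) (∑ j : Fin h.length, ((h[j]).2 - served u h r j))

/-- The number of tasks of the history `h` that are not completed at time `t`: the queue length
at time `t` when `h` is the list of all tasks received so far. -/
noncomputable def ServiceDiscipline.queueLength (disc : ServiceDiscipline) (u : ℝ) (h : History)
    (t : ℝ) : ℕ :=
  Set.ncard {j : Fin h.length | disc.served u h t j < (h[j]).2}

/-! ### The random inputs of the system of `N` servers -/

/-- What the dispatcher sees of one task: the time elapsed since the previous arrival, the set of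
servers sampled for it, a ranking of the servers that is used to break ties, and the service
requirement of the task. -/
abbrev Arrival (N : ℕ) := ℝ × Finset (Fin N) × Equiv.Perm (Fin N) × ℝ

/-- The data attached to one server: the internal randomness of its service discipline, and the
(remaining) service requirements of the tasks present at time `0` (the server uses only as many
of them as its initial queue length). -/
abbrev ServerData := ℝ × (ℕ → ℝ)

/-- The space of elementary outcomes: one `Arrival` for each task, one `ServerData` for each
server. -/
abbrev Outcome (N : ℕ) := (ℕ → Arrival N) × (Fin N → ServerData)

instance (N : ℕ) : MeasurableSpace (Equiv.Perm (Fin N)) := ⊤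

/-- The law of one arrival: an exponential interarrival time of rate `lam * N`, a uniformly random
set of `D` distinct servers, a uniformly random ranking, and a service requirement with law `ν`,
all independent. -/
noncomputable def arrivalLaw (N D : ℕ) (lam : ℝ) (ν : Measure ℝ) : Measure (Arrival N) :=
  (expMeasure (lam * N)).prod
    ((uniformOn {s : Finset (Fin N) | s.card = D}).prod
      ((uniformOn (Set.univ : Set (Equiv.Perm (Fin N)))).prod ν))

/-- The law of all inputs: independent arrivals, independent servers, the internal randomness of
every server being uniform on `[0, 1]`, and `ρ i` being the law of the service requirements of the
tasks initially present at server `i`. -/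
noncomputable def inputLaw (N D : ℕ) (lam : ℝ) (ν : Measure ℝ) (ρ : Fin N → Measure (ℕ → ℝ)) :
    Measure (Outcome N) :=
  (Measure.infinitePi fun _ : ℕ => arrivalLaw N D lam ν).prod
    (Measure.pi fun i => (volume.restrict (Set.Icc (0 : ℝ) 1)).prod (ρ i))

/-! ### The dynamics -/

section Dynamics

variable {N : ℕ}

/-- The arrival time of task number `n` (tasks are numbered from `0`). -/
noncomputable def arrivalTime (ω : Outcome N) (n : ℕ) : ℝ :=
  ∑ m ∈ Finset.range (n + 1), (ω.1 m).1

/-- The number of tasks that have arrived at the dispatcher up to time `t`: a Poisson process. -/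
noncomputable def arrivalCount (ω : Outcome N) (t : ℝ) : ℕ :=
  Set.ncard {n : ℕ | arrivalTime ω n ≤ t}

/-- `JoinsShortest q s σ i`: among the servers of the sampled set `s`, server `i` has the shortest
queue, ties being broken by the ranking `σ` (so, for a uniformly random `σ`, uniformly at
random). -/
def JoinsShortest (q : Fin N → ℕ) (s : Finset (Fin N)) (σ : Equiv.Perm (Fin N)) (i : Fin N) :
    Prop :=
  i ∈ s ∧ ∀ j ∈ s, q i < q j ∨ (q i = q j ∧ σ i ≤ σ j)

open Classical in
/-- The history of server `i` just before the arrival of task number `n`, when the system starts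
from the configuration `ξ`: the `ξ i` initial tasks, followed by those tasks of number less than
`n` that were sent to server `i`. Task number `n` is sent to a server whose queue at the time of its
arrival (not counting this task itself) is shortest among the sampled servers. -/
noncomputable def history (disc : ServiceDiscipline) (ξ : Fin N → ℕ) (ω : Outcome N) :
    ℕ → Fin N → History
  | 0, i => List.ofFn fun j : Fin (ξ i) => ((0 : ℝ), (ω.2 i).2 j)
  | n + 1, i =>
    if JoinsShortest
        (fun j => disc.queueLength (ω.2 j).1 (history disc ξ ω n j) (arrivalTime ω n))
        (ω.1 n).2.1 (ω.1 n).2.2.1 i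
    then history disc ξ ω n i ++ [(arrivalTime ω n, (ω.1 n).2.2.2)]
    else history disc ξ ω n i

/-- `X_t(i)`: the number of tasks at server `i` at time `t`, for the system started from `ξ`. -/
noncomputable def queue (disc : ServiceDiscipline) (ξ : Fin N → ℕ) (t : ℝ) (i : Fin N)
    (ω : Outcome N) : ℕ :=
  disc.queueLength (ω.2 i).1 (history disc ξ ω (arrivalCount ω t) i) t

/-- `m_k(x)`: the proportion of the servers that have exactly `k` tasks in the configuration
`x`. -/
noncomputable def empirical (k : ℕ) (x : Fin N → ℕ) : ℝ :=
  (∑ i, if x i = k then (1 : ℝ) else 0) / N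

/-- `m_k(t) = m_k(X_t)`, for the system started from `ξ`. -/
noncomputable def empiricalAt (disc : ServiceDiscipline) (ξ : Fin N → ℕ) (t : ℝ) (k : ℕ)
    (ω : Outcome N) : ℝ :=
  empirical k fun i => queue disc ξ t i ω

end Dynamics

end PowerOfD

/-! Take as state of a server the pair (internal randomness, history). Given these, queues evolve
deterministically between arrivals, so the system becomes a process that changes only at the points
of a marked Poisson process of rate c = λN. Let V(s, u) be the expectation at time t of F, the
proportion of servers with k tasks, when the state at time u is s (`value`). Everything is derived
from the renewal equation at the first jump (`value_eq`).

Coupling. Feed two states with the same arrivals. A task makes at most one more server differ, and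
only if its sample meets a server that differs already, which has probability at most D times the
proportion of such servers. So an arrival multiplies the discrepancy by at most 1 + D/N on average
(`exists_discrepancy_step_bound`), and V(·, u) is Lipschitz for the discrepancy with constant
exp(κ(t - u)), where κ = λD (`abs_value_sub_le`).

Variance. An arrival at time v changes V by at most exp(κ(t - v))/N, so for fixed server data the
variance is at most the integral of c (exp(κ(t - v))/N)² over [0, t], that is (exp(2κt) - 1)/(2DN)
(`value_sq_sub_sq_value_le`). Changing the data of one server changes V(·, 0) by at most exp(κt)/N,
so by an Efron–Stein bound the N independent servers contribute at most exp(2κt)/N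
(`integral_pi_sq_sub_sq_le`). The law of total variance adds the two terms, `variance_bound_le`
compares the sum with the stated constant, and a covariance is at most a common bound of the two
variances (`abs_integral_mul_sub_le`). -/

namespace PowerOfD

/-! ### Measurability of functions of finite lists -/

section Lists

variable {α β γ : Type*} [MeasurableSpace α] [MeasurableSpace β] [MeasurableSpace γ]

/-- Lists carry the σ-algebra of the disjoint union of the spaces `Fin n → α`. -/
instance listMeasurableSpace : MeasurableSpace (List α) :=
  ⨅ n : ℕ, MeasurableSpace.map (List.ofFn : (Fin n → α) → List α) inferInstance

theorem measurable_ofFn (n : ℕ) : Measurable (List.ofFn : (Fin n → α) → List α) := by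
  rw [measurable_iff_le_map]
  exact iInf_le (fun n : ℕ => MeasurableSpace.map (List.ofFn : (Fin n → α) → List α) inferInstance) n

theorem measurable_of_comp_ofFn {f : List α → β}
    (h : ∀ n, Measurable fun x : Fin n → α => f (List.ofFn x)) : Measurable f := by
  intro s hs
  rw [listMeasurableSpace, MeasurableSpace.measurableSet_iInf]
  intro n
  exact h n hs

/-- The σ-algebra of lists is defined length by length, but that of the product `List α × β` is not
visibly so. A list is therefore rebuilt from its length and its entries, both measurable, which
leaves a countable case distinction on the length. The default value is harmless: in the rebuilt
list only indices below the length are read. -/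
theorem measurable_list_prod [Inhabited α] {f : List α × β → γ}
    (h : ∀ n, Measurable fun p : (Fin n → α) × β => f (List.ofFn p.1, p.2)) : Measurable f := by
  have hget : ∀ i : ℕ, Measurable fun l : List α => l.getD i default := by
    intro i
    refine measurable_of_comp_ofFn fun n => ?_
    by_cases hi : i < n
    · simpa [List.getD, hi] using measurable_pi_apply (⟨i, hi⟩ : Fin n)
    · simp [List.getD, hi]
  have hlen : Measurable (List.length : List α → ℕ) :=
    measurable_of_comp_ofFn fun n => by simp
  have hG : Measurable fun q : ℕ × (List α × β) =>
      f (List.ofFn (fun i : Fin q.1 => q.2.1.getD i default), q.2.2) := by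
    refine measurable_from_prod_countable_right fun n => ?_
    exact (h n).comp
      (f := fun p : List α × β => ((fun i : Fin n => p.1.getD i default), p.2))
      ((measurable_pi_lambda _ fun i : Fin n => (hget i).comp measurable_fst).prodMk measurable_snd)
  convert hG.comp ((hlen.comp measurable_fst).prodMk measurable_id) using 1
  funext ⟨l, b⟩
  simp

theorem measurable_append_singleton [Inhabited α] :
    Measurable fun p : List α × α => p.1 ++ [p.2] := by
  refine measurable_list_prod fun n => ?_
  have : (fun p : (Fin n → α) × α => List.ofFn p.1 ++ [p.2])
      = fun p => List.ofFn (Fin.snoc (α := fun _ => α) p.1 p.2 : Fin (n + 1) → α) := by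
    funext p
    rw [List.ofFn_succ']
    simp
  rw [this]
  refine (measurable_ofFn (n + 1)).comp (measurable_pi_lambda _ fun i => ?_)
  refine Fin.lastCases ?_ (fun j => ?_) i
  · simpa using measurable_snd
  · simp only [Fin.snoc_castSucc]
    fun_prop

end Lists

/-! ### The state of the system -/

/-- The state of `N` servers: for each one, its internal randomness and its history. -/
abbrev State (N : ℕ) := Fin N → ℝ × History

/-- What the dispatcher sees of one task, apart from its arrival time. -/
abbrev Mark (N : ℕ) := Finset (Fin N) × Equiv.Perm (Fin N) × ℝ

variable {N : ℕ}

theorem measurable_queueLength (disc : ServiceDiscipline) :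
    Measurable fun p : (ℝ × History) × ℝ => disc.queueLength p.1.1 p.1.2 p.2 := by
  have key : Measurable fun p : History × (ℝ × ℝ) => disc.queueLength p.2.1 p.1 p.2.2 := by
    refine measurable_list_prod fun n => ?_
    have h : (fun p : (Fin n → ℝ × ℝ) × (ℝ × ℝ) =>
        disc.queueLength p.2.1 (List.ofFn p.1) p.2.2) = fun p =>
        Set.ncard {j : Fin n | disc.served p.2.1 (List.ofFn p.1) p.2.2 j < (p.1 j).2} := by
      funext p
      rw [ServiceDiscipline.queueLength]
      refine Set.ncard_congr (fun j _ => Fin.cast (by simp) j) ?_ ?_ ?_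
      · intro j hj
        have hj' : disc.served p.2.1 (List.ofFn p.1) p.2.2 j < ((List.ofFn p.1)[(j : ℕ)]).2 := hj
        rwa [List.getElem_ofFn] at hj'
      · intro i j _ _ hij
        simpa using hij
      · intro j hj
        exact ⟨Fin.cast (by simp) j, by simpa using hj, by simp⟩
    rw [h]
    refine measurable_ncard.comp (measurable_set_iff.2 fun j => ?_)
    refine measurableSet_setOfPred.1 (measurableSet_lt (f := fun p : (Fin n → ℝ × ℝ) × (ℝ × ℝ) =>
      disc.served p.2.1 (List.ofFn p.1) p.2.2 j) (g := fun p => (p.1 j).2) ?_ ?_)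
    · exact (disc.measurable_served n j).comp
        (f := fun p : (Fin n → ℝ × ℝ) × (ℝ × ℝ) => (p.2.1, p.1, p.2.2)) (by fun_prop)
    · fun_prop
  exact key.comp (f := fun p : (ℝ × History) × ℝ => (p.1.2, p.1.1, p.2)) (by fun_prop)

open Classical in
/-- The state after a task with mark `m` has arrived at time `v`. -/
noncomputable def step (disc : ServiceDiscipline) (s : State N) (v : ℝ) (m : Mark N) : State N :=
  fun i => ((s i).1,
    if JoinsShortest (fun j => disc.queueLength (s j).1 (s j).2 v) m.1 m.2.1 i
    then (s i).2 ++ [(v, m.2.2)] else (s i).2)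

theorem measurable_step (disc : ServiceDiscipline) :
    Measurable fun p : State N × ℝ × Mark N => step disc p.1 p.2.1 p.2.2 := by
  classical
  refine measurable_pi_lambda _ fun i => Measurable.prodMk (by fun_prop) ?_
  refine Measurable.ite ?_ ?_ (by fun_prop)
  · have hd : MeasurableSet {x : (Fin N → ℕ) × Finset (Fin N) × Equiv.Perm (Fin N) |
        JoinsShortest x.1 x.2.1 x.2.2 i} := (Set.to_countable _).measurableSet
    refine hd.preimage (f := fun p : State N × ℝ × Mark N =>
      ((fun j => disc.queueLength (p.1 j).1 (p.1 j).2 p.2.1), p.2.2.1, p.2.2.2.1)) ?_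
    refine Measurable.prodMk (measurable_pi_lambda _ fun j => ?_) (by fun_prop)
    exact (measurable_queueLength disc).comp
      (f := fun p : State N × ℝ × Mark N => (p.1 j, p.2.1)) (by fun_prop)
  · exact measurable_append_singleton.comp
      (f := fun p : State N × ℝ × Mark N => ((p.1 i).2, (p.2.1, p.2.2.2.2))) (by fun_prop)

/-- The proportion of servers with `k` tasks at time `t`, if nothing arrives after the state `s`. -/
noncomputable def observe (disc : ServiceDiscipline) (t : ℝ) (k : ℕ) (s : State N) : ℝ :=
  empirical k fun i => disc.queueLength (s i).1 (s i).2 t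

theorem measurable_observe (disc : ServiceDiscipline) (t : ℝ) (k : ℕ) :
    Measurable (observe disc t k : State N → ℝ) := by
  have : ∀ i, Measurable fun s : State N => disc.queueLength (s i).1 (s i).2 t := fun i =>
    (measurable_queueLength disc).comp (f := fun s : State N => (s i, t)) (by fun_prop)
  refine Measurable.div_const (Finset.measurable_sum _ fun i _ => ?_) _
  exact Measurable.ite ((this i) (measurableSet_singleton k)) measurable_const measurable_const

/-! ### Coupling: the discrepancy of two states fed with the same arrivals -/

open Classical in
/-- The proportion of servers at which two states differ. -/
noncomputable def discrepancy (s s' : State N) : ℝ :=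
  (Finset.univ.filter fun i => s i ≠ s' i).card / N

/-- The chosen server is the minimum of the sample for the lexicographic order on (queue, rank), and
ranks are distinct. -/
theorem JoinsShortest.eq {q : Fin N → ℕ} {s : Finset (Fin N)} {σ : Equiv.Perm (Fin N)}
    {i j : Fin N} (hi : JoinsShortest q s σ i) (hj : JoinsShortest q s σ j) : i = j := by
  have h1 := hi.2 j hj.1
  have h2 := hj.2 i hi.1
  exact σ.injective (le_antisymm (by omega) (by omega))

theorem discrepancy_nonneg (s s' : State N) : 0 ≤ discrepancy s s' := by
  unfold discrepancy; positivity

theorem discrepancy_le_of_forall_eq {s s' : State N} (i : Fin N)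
    (h : ∀ j, j ≠ i → s j = s' j) : discrepancy s s' ≤ 1 / N := by
  classical
  refine div_le_div_of_nonneg_right ?_ (by positivity)
  have : (Finset.univ.filter fun j => s j ≠ s' j) ⊆ {i} := fun j hj => by
    by_contra hne
    exact (Finset.mem_filter.1 hj).2 (h j (by simpa using hne))
  exact_mod_cast Finset.card_le_card this

theorem discrepancy_step_self_le (disc : ServiceDiscipline) (s : State N) (v : ℝ) (m : Mark N) :
    discrepancy s (step disc s v m) ≤ 1 / N := by
  classical
  by_cases h : ∃ i, JoinsShortest (fun j => disc.queueLength (s j).1 (s j).2 v) m.1 m.2.1 i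
  · obtain ⟨i, hi⟩ := h
    refine discrepancy_le_of_forall_eq i fun j hj => ?_
    simp only [step]
    rw [if_neg fun h => hj (h.eq hi)]
  · push Not at h
    have : discrepancy s (step disc s v m) = 0 := by simp [discrepancy, step, h]
    rw [this]; positivity

/-- The queue of a server is a function of its own state, so only the servers that differ
contribute, each at most 1. -/
theorem abs_observe_sub_le (disc : ServiceDiscipline) (t : ℝ) (k : ℕ) (s s' : State N) :
    |observe disc t k s - observe disc t k s'| ≤ discrepancy s s' := by
  classical
  unfold observe empirical discrepancy
  rw [← sub_div, abs_div, Nat.abs_cast, ← Finset.sum_sub_distrib]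
  refine div_le_div_of_nonneg_right ?_ (by positivity)
  refine (Finset.abs_sum_le_sum_abs _ _).trans ?_
  rw [Finset.card_filter, Nat.cast_sum]
  refine Finset.sum_le_sum fun i _ => ?_
  by_cases h : s i = s' i
  · simp [h]
  · simp only [ne_eq, h, not_false_eq_true, if_true]
    split_ifs <;> simp

theorem observe_nonneg (disc : ServiceDiscipline) (t : ℝ) (k : ℕ) (s : State N) :
    0 ≤ observe disc t k s :=
  div_nonneg (Finset.sum_nonneg fun _ _ => by split_ifs <;> simp) (by positivity)

theorem observe_le_one (disc : ServiceDiscipline) (t : ℝ) (k : ℕ) (s : State N) :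
    observe disc t k s ≤ 1 := by
  refine div_le_one_of_le₀ ?_ (by positivity)
  refine (Finset.sum_le_card_nsmul _ _ 1 fun _ _ => by split_ifs <;> simp).trans ?_
  simp

open Classical in
/-- A task can create at most one new server at which two states differ, and only if it samples a
server at which they differ already. -/
theorem discrepancy_step_le (disc : ServiceDiscipline) (s s' : State N) (v : ℝ) (m : Mark N) :
    discrepancy (step disc s v m) (step disc s' v m) ≤
      discrepancy s s' + (if ∃ i ∈ m.1, s i ≠ s' i then 1 else 0) / N := by
  unfold discrepancy
  rw [← add_div]
  refine div_le_div_of_nonneg_right ?_ (by positivity)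
  set A := Finset.univ.filter fun i => s i ≠ s' i with hA
  set q := fun j => disc.queueLength (s j).1 (s j).2 v with hq
  set q' := fun j => disc.queueLength (s' j).1 (s' j).2 v with hq'
  have hqq : ∀ j, s j = s' j → q j = q' j := fun j hj => by simp only [hq, hq', hj]
  -- A server that agreed before can differ afterwards only if exactly one of the two copies sends
  -- it the task.
  have hnew : ∀ i, i ∉ A → step disc s v m i ≠ step disc s' v m i →
      (JoinsShortest q m.1 m.2.1 i ∧ ¬ JoinsShortest q' m.1 m.2.1 i) ∨
      (¬ JoinsShortest q m.1 m.2.1 i ∧ JoinsShortest q' m.1 m.2.1 i) := by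
    intro i hi hne
    have hs : s i = s' i := by simpa [hA] using hi
    by_cases h1 : JoinsShortest q m.1 m.2.1 i <;> by_cases h2 : JoinsShortest q' m.1 m.2.1 i
    · exact absurd (by simp only [step]; rw [if_pos h1, if_pos h2, hs]) hne
    · exact Or.inl ⟨h1, h2⟩
    · exact Or.inr ⟨h1, h2⟩
    · exact absurd (by simp only [step]; rw [if_neg h1, if_neg h2, hs]) hne
  by_cases hex : ∃ i ∈ m.1, s i ≠ s' i
  · rw [if_pos hex]
    -- The copies may choose different servers, but not both outside `A`: there they see the same
    -- queues, so each choice would have to beat the other. Hence one new discrepant server, not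
    -- two.
    have hcross : ∀ i j, i ∉ A → j ∉ A → JoinsShortest q m.1 m.2.1 i →
        JoinsShortest q' m.1 m.2.1 j → i = j := by
      intro i j hi hj h1 h2
      have hsi := hqq i (by simpa [hA] using hi)
      have hsj := hqq j (by simpa [hA] using hj)
      have e1 := h1.2 j h2.1
      have e2 := h2.2 i h1.1
      exact m.2.1.injective (le_antisymm (by omega) (by omega))
    set B := Finset.univ.filter fun i => step disc s v m i ≠ step disc s' v m i with hB
    have hcard : (B \ A).card ≤ 1 := by
      refine Finset.card_le_one.2 fun i hi j hj => ?_
      simp only [Finset.mem_sdiff, hB, Finset.mem_filter, Finset.mem_univ, true_and] at hi hj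
      rcases hnew i hi.2 hi.1 with h | h <;> rcases hnew j hj.2 hj.1 with h' | h'
      · exact h.1.eq h'.1
      · exact hcross i j hi.2 hj.2 h.1 h'.2
      · exact (hcross j i hj.2 hi.2 h'.1 h.2).symm
      · exact h.2.eq h'.2
    have : B.card ≤ A.card + 1 := by
      have := Finset.le_card_sdiff A B
      omega
    exact_mod_cast this
  · rw [if_neg hex, add_zero]
    push Not at hex
    have hJ : ∀ i, JoinsShortest q m.1 m.2.1 i ↔ JoinsShortest q' m.1 m.2.1 i := by
      intro i
      refine and_congr_right fun hi => forall₂_congr fun j hj => ?_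
      rw [hqq i (hex i hi), hqq j (hex j hj)]
    refine Nat.cast_le.2 (Finset.card_le_card fun i hi => ?_)
    by_contra h
    have := hnew i h (by simpa using hi)
    have := hJ i
    tauto

/-! ### Integrals against the exponential law -/

theorem integral_expMeasure {c : ℝ} (hc : 0 < c) (f : ℝ → ℝ) :
    ∫ x, f x ∂expMeasure c = ∫ x in Set.Ici 0, c * Real.exp (-(c * x)) * f x := by
  have hm : Measurable (exponentialPDF c) :=
    (measurable_exponentialPDFReal c).ennreal_ofReal
  have h : expMeasure c = volume.withDensity (exponentialPDF c) := rfl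
  rw [h, integral_withDensity_eq_integral_toReal_smul hm (by simp [exponentialPDF]),
    ← integral_indicator measurableSet_Ici]
  congr 1
  funext x
  by_cases hx : 0 ≤ x
  · rw [Set.indicator_of_mem (Set.mem_Ici.2 hx), exponentialPDF_of_nonneg hx,
      ENNReal.toReal_ofReal (by positivity), smul_eq_mul]
  · rw [Set.indicator_of_notMem (by simpa using hx), exponentialPDF_of_neg (not_le.1 hx)]
    simp

theorem expMeasure_real_Ioi {c : ℝ} (hc : 0 < c) {a : ℝ} (ha : 0 ≤ a) :
    (expMeasure c).real (Set.Ioi a) = Real.exp (-(c * a)) := by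
  have := isProbabilityMeasure_expMeasure hc
  rw [← Set.compl_Iic, probReal_compl_eq_one_sub measurableSet_Iic, ← cdf_eq_real,
    cdf_expMeasure_eq hc, if_pos ha]
  ring

/-- Splitting on whether the first jump, at time `u + τ`, comes by time `t`; it fails to with
probability exp(-c(t - u)). -/
theorem integral_expMeasure_ite {c : ℝ} (hc : 0 < c) {u t : ℝ} (hut : u ≤ t) {φ : ℝ → ℝ}
    (hφ : Measurable φ) {C : ℝ} (hC : ∀ v, |φ v| ≤ C) (a : ℝ) :
    ∫ τ, (if u + τ ≤ t then φ (u + τ) else a) ∂expMeasure c =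
      Real.exp (-(c * (t - u))) * a + ∫ v in u..t, c * Real.exp (-(c * (v - u))) * φ v := by
  have := isProbabilityMeasure_expMeasure hc
  have hsplit : (fun τ => if u + τ ≤ t then φ (u + τ) else a) = fun τ =>
      (Set.Iic (t - u)).indicator (fun τ => φ (u + τ)) τ
        + (Set.Ioi (t - u)).indicator (fun _ => a) τ := by
    funext τ
    by_cases h : u + τ ≤ t
    · have h1 : τ ∈ Set.Iic (t - u) := by simp; linarith
      have h2 : τ ∉ Set.Ioi (t - u) := by simp; linarith
      simp only [h, if_true, Set.indicator_of_mem h1, Set.indicator_of_notMem h2, add_zero]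
    · have h1 : τ ∉ Set.Iic (t - u) := by simp; linarith
      have h2 : τ ∈ Set.Ioi (t - u) := by simp; linarith
      simp only [h, if_false, Set.indicator_of_notMem h1, Set.indicator_of_mem h2, zero_add]
  have hint : Integrable (fun τ => φ (u + τ)) (expMeasure c) :=
    Integrable.of_bound (hφ.comp (measurable_const_add u)).aestronglyMeasurable C
      (Filter.Eventually.of_forall fun τ => hC _)
  rw [hsplit, integral_add (hint.indicator measurableSet_Iic)
    ((integrable_const a).indicator measurableSet_Ioi), integral_indicator measurableSet_Ioi,
    setIntegral_const, expMeasure_real_Ioi hc (by linarith), smul_eq_mul, add_comm,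
    integral_expMeasure hc]
  congr 1
  have h3 : (fun x => c * Real.exp (-(c * x)) * (Set.Iic (t - u)).indicator (fun τ => φ (u + τ)) x)
      = (Set.Iic (t - u)).indicator fun x => c * Real.exp (-(c * x)) * φ (u + x) := by
    funext x
    by_cases h : x ∈ Set.Iic (t - u)
    · simp only [Set.indicator_of_mem h]
    · simp only [Set.indicator_of_notMem h, mul_zero]
  rw [h3, setIntegral_indicator measurableSet_Iic, Set.Ici_inter_Iic, integral_Icc_eq_integral_Ioc,
    ← intervalIntegral.integral_of_le (by linarith)]
  have h4 := intervalIntegral.integral_comp_add_left (a := 0) (b := t - u)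
    (fun v => c * Real.exp (-(c * (v - u))) * φ v) u
  simpa using h4

/-! ### Shifting a sequence of independent variables -/

/-- Separates the first jump from the later ones. It is checked on finite cylinders, which determine
the product law. -/
theorem measurePreserving_cons {α : Type*} [MeasurableSpace α] (μ : Measure α)
    [IsProbabilityMeasure μ] :
    MeasurePreserving (fun p : α × (ℕ → α) => (fun n => Nat.casesOn n p.1 p.2 : ℕ → α))
      (μ.prod (Measure.infinitePi fun _ : ℕ => μ)) (Measure.infinitePi fun _ : ℕ => μ) := by
  have hm : Measurable (fun p : α × (ℕ → α) => (fun n => Nat.casesOn n p.1 p.2 : ℕ → α)) := by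
    refine measurable_pi_lambda _ fun n => ?_
    cases n <;> fun_prop
  refine ⟨hm, Measure.eq_infinitePi _ fun s t ht => ?_⟩
  classical
  rw [Measure.map_apply hm (MeasurableSet.pi s.countable_toSet fun i _ => ht i)]
  obtain ⟨K, hK⟩ := s.exists_nat_subset_range
  -- Padding with `Set.univ` turns the index set into an initial segment, from which the factor at 0
  -- splits off.
  set t' : ℕ → Set α := fun i => if i ∈ s then t i else Set.univ with ht'
  have hmt' : ∀ i, MeasurableSet (t' i) := fun i => by
    simp only [ht']; split_ifs
    exacts [ht i, MeasurableSet.univ]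
  have hpre : (fun p : α × (ℕ → α) => (fun n => Nat.casesOn n p.1 p.2 : ℕ → α)) ⁻¹'
      Set.pi (s : Set ℕ) t = t' 0 ×ˢ Set.pi (Finset.range K : Set ℕ) fun i => t' (i + 1) := by
    ext ⟨a, x⟩
    simp only [Set.mem_preimage, Set.mem_pi, Finset.mem_coe, Set.mem_prod, Finset.mem_range, ht']
    constructor
    · intro h
      refine ⟨?_, fun i _ => ?_⟩ <;> split_ifs with hi
      · exact h 0 hi
      · trivial
      · exact h (i + 1) hi
      · trivial
    · rintro ⟨h0, h1⟩ i hi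
      cases i with
      | zero => simpa [hi] using h0
      | succ i =>
        have := h1 i (by have := Finset.mem_range.1 (hK hi); omega)
        simpa [hi] using this
  rw [hpre, Measure.prod_prod, Measure.infinitePi_pi _ fun i _ => hmt' (i + 1)]
  have hprod : ∏ i ∈ s, μ (t i) = ∏ i ∈ Finset.range (K + 1), μ (t' i) := by
    rw [Finset.prod_congr rfl fun i hi => (by simp [ht', hi] : μ (t i) = μ (t' i))]
    refine Finset.prod_subset (hK.trans (Finset.range_mono (Nat.le_succ K))) fun i _ hi => ?_
    simp [ht', hi]
  rw [hprod, Finset.prod_range_succ', mul_comm]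

/-! ### A jump process driven by a Poisson process with marks -/

section Jump

variable {S M : Type*}

/-- The time of jump number `n` when the process starts at time `u`. -/
noncomputable def jumpTime (u : ℝ) (x : ℕ → ℝ × M) (n : ℕ) : ℝ :=
  u + ∑ m ∈ Finset.range (n + 1), (x m).1

/-- The state after `n` jumps when the process starts in the state `s` at time `u`. -/
noncomputable def jumpState (f : S → ℝ → M → S) (s : S) (u : ℝ) (x : ℕ → ℝ × M) : ℕ → S
  | 0 => s
  | n + 1 => f (jumpState f s u x n) (jumpTime u x n) (x n).2

/-- The state at time `t` when the process starts in the state `s` at time `u`. -/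
noncomputable def stateAt (f : S → ℝ → M → S) (t : ℝ) (s : S) (u : ℝ) (x : ℕ → ℝ × M) : S :=
  jumpState f s u x (Set.ncard {n | jumpTime u x n ≤ t})

theorem jumpTime_succ (u : ℝ) (x : ℕ → ℝ × M) (n : ℕ) :
    jumpTime u x (n + 1) = jumpTime (u + (x 0).1) (fun n => x (n + 1)) n := by
  simp only [jumpTime]
  rw [Finset.sum_range_succ']
  ring

theorem jumpState_succ (f : S → ℝ → M → S) (s : S) (u : ℝ) (x : ℕ → ℝ × M) (n : ℕ) :
    jumpState f s u x (n + 1) =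
      jumpState f (f s (u + (x 0).1) (x 0).2) (u + (x 0).1) (fun n => x (n + 1)) n := by
  induction n with
  | zero => simp [jumpState, jumpTime]
  | succ n ih =>
    rw [jumpState, ih, jumpState, jumpTime_succ]

theorem jumpTime_mono {u : ℝ} {x : ℕ → ℝ × M} (hx : ∀ n, 0 ≤ (x n).1) : Monotone (jumpTime u x) := by
  refine monotone_nat_of_le_succ fun n => ?_
  rw [jumpTime, jumpTime, Finset.sum_range_succ _ (n + 1)]
  linarith [hx (n + 1)]

theorem stateAt_of_lt (f : S → ℝ → M → S) {t : ℝ} (s : S) {u : ℝ} {x : ℕ → ℝ × M}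
    (hx : ∀ n, 0 ≤ (x n).1) (h : t < u + (x 0).1) : stateAt f t s u x = s := by
  have : {n | jumpTime u x n ≤ t} = ∅ := by
    refine Set.eq_empty_of_forall_notMem fun n hn => ?_
    have h0 := jumpTime_mono (u := u) hx (Nat.zero_le n)
    have : jumpTime u x 0 = u + (x 0).1 := by simp [jumpTime]
    have hn' : jumpTime u x n ≤ t := hn
    linarith
  rw [stateAt, this, Set.ncard_empty, jumpState]

/-- Finiteness is essential: `Set.ncard` of an infinite set is 0, so with infinitely many jumps by
time `t` the left side would be `s`. -/
theorem stateAt_of_le (f : S → ℝ → M → S) {t : ℝ} (s : S) {u : ℝ} {x : ℕ → ℝ × M}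
    (hx : {n | jumpTime u x n ≤ t}.Finite) (h : u + (x 0).1 ≤ t) :
    stateAt f t s u x =
      stateAt f t (f s (u + (x 0).1) (x 0).2) (u + (x 0).1) (fun n => x (n + 1)) := by
  set A := {n | jumpTime (u + (x 0).1) (fun n => x (n + 1)) n ≤ t} with hA
  have hset : {n | jumpTime u x n ≤ t} = insert 0 (Nat.succ '' A) := by
    ext n
    cases n with
    | zero => simpa [jumpTime] using h
    | succ n => simp [hA, jumpTime_succ]
  have hfin : (Nat.succ '' A).Finite := by
    rw [hset] at hx
    exact hx.subset (Set.subset_insert _ _)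
  rw [stateAt, hset, Set.ncard_insert_of_notMem (by simp) hfin,
    Set.ncard_image_of_injective _ Nat.succ_injective, jumpState_succ, stateAt]

variable [MeasurableSpace S] [MeasurableSpace M]

theorem measurable_jumpTime (n : ℕ) :
    Measurable fun p : ℝ × (ℕ → ℝ × M) => jumpTime p.1 p.2 n := by
  unfold jumpTime
  fun_prop

theorem measurable_jumpState {f : S → ℝ → M → S}
    (hf : Measurable fun p : S × ℝ × M => f p.1 p.2.1 p.2.2) (n : ℕ) :
    Measurable fun p : S × ℝ × (ℕ → ℝ × M) => jumpState f p.1 p.2.1 p.2.2 n := by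
  induction n with
  | zero => exact measurable_fst
  | succ n ih =>
    refine hf.comp (f := fun p : S × ℝ × (ℕ → ℝ × M) =>
      (jumpState f p.1 p.2.1 p.2.2 n, jumpTime p.2.1 p.2.2 n, (p.2.2 n).2)) ?_
    exact ih.prodMk (((measurable_jumpTime n).comp measurable_snd).prodMk (by fun_prop))

theorem measurable_stateAt {f : S → ℝ → M → S}
    (hf : Measurable fun p : S × ℝ × M => f p.1 p.2.1 p.2.2) (t : ℝ) :
    Measurable fun p : S × ℝ × (ℕ → ℝ × M) => stateAt f t p.1 p.2.1 p.2.2 := by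
  have h1 : Measurable fun q : ℕ × (S × ℝ × (ℕ → ℝ × M)) =>
      jumpState f q.2.1 q.2.2.1 q.2.2.2 q.1 :=
    measurable_from_prod_countable_right fun n => measurable_jumpState hf n
  refine h1.comp (f := fun p : S × ℝ × (ℕ → ℝ × M) =>
    (Set.ncard {n | jumpTime p.2.1 p.2.2 n ≤ t}, p)) (Measurable.prodMk ?_ measurable_id)
  refine measurable_ncard.comp (measurable_set_iff.2 fun n => measurableSet_setOfPred.1 ?_)
  exact measurableSet_le (f := fun p : S × ℝ × (ℕ → ℝ × M) => jumpTime p.2.1 p.2.2 n)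
    ((measurable_jumpTime n).comp measurable_snd) measurable_const

/-- The law of the interarrival times and marks: independent, the interarrival times being
exponential of rate `c`. -/
noncomputable def jumpLaw (c : ℝ) (μ : Measure M) : Measure (ℕ → ℝ × M) :=
  Measure.infinitePi fun _ : ℕ => (expMeasure c).prod μ

/-- The expectation of `F` at time `t` when the process starts in the state `s` at time `u`. -/
noncomputable def value (c : ℝ) (μ : Measure M) (f : S → ℝ → M → S) (t : ℝ) (F : S → ℝ) (s : S)
    (u : ℝ) : ℝ :=
  ∫ x, F (stateAt f t s u x) ∂jumpLaw c μ

/-! ### Almost sure properties of the jumps, and the renewal equation -/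

variable {c : ℝ} {μ : Measure M} [IsProbabilityMeasure μ]

theorem isProbabilityMeasure_jumpLaw (hc : 0 < c) : IsProbabilityMeasure (jumpLaw c μ) := by
  have := isProbabilityMeasure_expMeasure hc
  unfold jumpLaw
  infer_instance

theorem ae_expMeasure_nonneg : ∀ᵐ x ∂expMeasure c, 0 ≤ x := by
  rw [ae_iff]
  have h : expMeasure c = volume.withDensity (exponentialPDF c) := rfl
  have hs : {x : ℝ | ¬ 0 ≤ x} = Set.Iio 0 := by ext; simp
  rw [hs, h, withDensity_apply _ measurableSet_Iio]
  exact lintegral_exponentialPDF_of_nonpos le_rfl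

theorem ae_jumpLaw_nonneg (hc : 0 < c) : ∀ᵐ x ∂jumpLaw c μ, ∀ n, 0 ≤ (x n).1 := by
  have := isProbabilityMeasure_expMeasure hc
  refine ae_all_iff.2 fun n => ?_
  have h1 : ∀ᵐ y ∂(expMeasure c).prod μ, 0 ≤ y.1 :=
    Measure.quasiMeasurePreserving_fst.ae ae_expMeasure_nonneg
  exact (measurePreserving_eval_infinitePi
    (fun _ : ℕ => (expMeasure c).prod μ) n).quasiMeasurePreserving.ae h1

/-- The first n gaps are all at most `t` with probability p ^ n, where p < 1. -/
theorem ae_jumpLaw_exists_lt (hc : 0 < c) {t : ℝ} (ht : 0 ≤ t) :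
    ∀ᵐ x ∂jumpLaw c μ, ∃ n, t < (x n).1 := by
  have := isProbabilityMeasure_expMeasure hc
  set p := expMeasure c (Set.Iic t) with hp
  have hp1 : p < 1 := by
    have h1 := expMeasure_real_Ioi hc ht
    have h2 : (expMeasure c).real (Set.Iic t) < 1 := by
      rw [← Set.compl_Ioi, probReal_compl_eq_one_sub measurableSet_Ioi, h1]
      linarith [Real.exp_pos (-(c * t))]
    rw [measureReal_def, ← ENNReal.toReal_one] at h2
    exact (ENNReal.toReal_lt_toReal (measure_ne_top _ _) ENNReal.one_ne_top).1 h2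
  have hle : ∀ n : ℕ, jumpLaw c μ {x | ¬ ∃ n, t < (x n).1} ≤ p ^ n := by
    intro n
    have hsub : {x : ℕ → ℝ × M | ¬ ∃ n, t < (x n).1} ⊆
        Set.pi (Finset.range n : Set ℕ) fun _ => Set.Iic t ×ˢ Set.univ := by
      intro x hx i _
      have hx' : ¬ ∃ n, t < (x n).1 := hx
      push Not at hx'
      simpa using hx' i
    refine (measure_mono hsub).trans_eq ?_
    rw [jumpLaw, Measure.infinitePi_pi _ fun _ _ => measurableSet_Iic.prod MeasurableSet.univ]
    simp [Measure.prod_prod, hp]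
  rw [ae_iff]
  exact le_antisymm (ge_of_tendsto' (ENNReal.tendsto_pow_atTop_nhds_zero_of_lt_one hp1) hle)
    zero_le

/-- Gaps being nonnegative, a single gap longer than `t` puts its own jump and all later ones after
`t`, for every start `u ≥ 0` at once. -/
theorem ae_jumpLaw_finite (hc : 0 < c) {t : ℝ} (ht : 0 ≤ t) :
    ∀ᵐ x ∂jumpLaw c μ, ∀ u, 0 ≤ u → {n | jumpTime u x n ≤ t}.Finite := by
  filter_upwards [ae_jumpLaw_nonneg hc, ae_jumpLaw_exists_lt hc ht] with x hx ⟨n, hn⟩ u hu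
  refine (Set.finite_lt_nat n).subset fun k hk => ?_
  have hk' : jumpTime u x k ≤ t := hk
  by_contra hnk
  have hnk : n ≤ k := not_lt.1 hnk
  have h1 : (x n).1 ≤ ∑ m ∈ Finset.range (k + 1), (x m).1 :=
    Finset.single_le_sum (f := fun m => (x m).1) (fun i _ => hx i) (by simp; omega)
  unfold jumpTime at hk'
  linarith

omit [MeasurableSpace S] in
theorem abs_value_le (hc : 0 < c) {f : S → ℝ → M → S} {t : ℝ} {F : S → ℝ} {C : ℝ}
    (hC : ∀ s, |F s| ≤ C) (s : S) (u : ℝ) : |value c μ f t F s u| ≤ C := by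
  have := isProbabilityMeasure_jumpLaw (μ := μ) hc
  have := norm_integral_le_of_norm_le_const (μ := jumpLaw c μ)
    (f := fun x => F (stateAt f t s u x)) (Filter.Eventually.of_forall fun x => hC _)
  simpa [value] using this

theorem measurable_value (hc : 0 < c) {f : S → ℝ → M → S}
    (hf : Measurable fun p : S × ℝ × M => f p.1 p.2.1 p.2.2) (t : ℝ) {F : S → ℝ}
    (hF : Measurable F) : Measurable fun p : S × ℝ => value c μ f t F p.1 p.2 := by
  have := isProbabilityMeasure_jumpLaw (μ := μ) hc
  refine (StronglyMeasurable.integral_prod_right' (ν := jumpLaw c μ)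
    (f := fun q : (S × ℝ) × (ℕ → ℝ × M) => F (stateAt f t q.1.1 q.1.2 q.2)) ?_).measurable
  refine Measurable.stronglyMeasurable ?_
  exact hF.comp ((measurable_stateAt hf t).comp
    (f := fun q : (S × ℝ) × (ℕ → ℝ × M) => (q.1.1, q.1.2, q.2)) (by fun_prop))

/-- The renewal equation at the first jump. -/
theorem value_eq (hc : 0 < c) {f : S → ℝ → M → S}
    (hf : Measurable fun p : S × ℝ × M => f p.1 p.2.1 p.2.2) {t : ℝ} {F : S → ℝ}
    (hF : Measurable F) {C : ℝ} (hC : ∀ s, |F s| ≤ C) (s : S) {u : ℝ} (hu : 0 ≤ u) (hut : u ≤ t) :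
    value c μ f t F s u = Real.exp (-(c * (t - u))) * F s +
      ∫ v in u..t, c * Real.exp (-(c * (v - u))) * ∫ m, value c μ f t F (f s v m) v ∂μ := by
  have := isProbabilityMeasure_expMeasure hc
  have := isProbabilityMeasure_jumpLaw (μ := μ) hc
  have hmp : MeasurePreserving
      (fun p : (ℝ × M) × (ℕ → ℝ × M) => (fun n => Nat.casesOn n p.1 p.2 : ℕ → ℝ × M))
      (((expMeasure c).prod μ).prod (jumpLaw c μ)) (jumpLaw c μ) :=
    measurePreserving_cons ((expMeasure c).prod μ)
  -- The payoff in terms of the first jump and the remaining ones. It is the true payoff off the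
  -- null set where some gap is negative or infinitely many jumps occur by time `t`.
  set φ : (ℝ × M) × (ℕ → ℝ × M) → ℝ := fun p =>
    if u + p.1.1 ≤ t then F (stateAt f t (f s (u + p.1.1) p.1.2) (u + p.1.1) p.2) else F s with hφ
  have hFm : Measurable fun p : S × ℝ × (ℕ → ℝ × M) => F (stateAt f t p.1 p.2.1 p.2.2) :=
    hF.comp (measurable_stateAt hf t)
  have hfs : Measurable fun p : ℝ × M => f s p.1 p.2 :=
    hf.comp (f := fun p : ℝ × M => (s, p)) (by fun_prop)
  have hφm : Measurable φ := by
    refine Measurable.ite (measurableSet_le (by fun_prop) measurable_const) ?_ measurable_const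
    refine hFm.comp (f := fun p : (ℝ × M) × (ℕ → ℝ × M) =>
      (f s (u + p.1.1) p.1.2, u + p.1.1, p.2)) (Measurable.prodMk ?_ (by fun_prop))
    exact hfs.comp (f := fun p : (ℝ × M) × (ℕ → ℝ × M) => (u + p.1.1, p.1.2)) (by fun_prop)
  have hφC : ∀ p, |φ p| ≤ C := fun p => by
    simp only [hφ]; split_ifs
    exacts [hC _, hC _]
  have hV : Measurable fun p : ℝ × M => value c μ f t F (f s p.1 p.2) p.1 :=
    (measurable_value (μ := μ) hc hf t hF).comp (f := fun p : ℝ × M => (f s p.1 p.2, p.1))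
      (hfs.prodMk measurable_fst)
  have h1 : value c μ f t F s u = ∫ p, φ p ∂((expMeasure c).prod μ).prod (jumpLaw c μ) := by
    unfold value
    conv_lhs => rw [← hmp.map_eq]
    have hFs : Measurable fun x : ℕ → ℝ × M => F (stateAt f t s u x) :=
      hFm.comp (f := fun x : ℕ → ℝ × M => (s, u, x)) (by fun_prop)
    rw [integral_map hmp.measurable.aemeasurable hFs.aestronglyMeasurable]
    refine integral_congr_ae ?_
    filter_upwards [hmp.quasiMeasurePreserving.ae (ae_jumpLaw_nonneg hc),
      hmp.quasiMeasurePreserving.ae (ae_jumpLaw_finite hc (hu.trans hut))] with p hp1 hp2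
    simp only [hφ]
    split_ifs with h
    · rw [stateAt_of_le f s (hp2 u hu) h]
      rfl
    · rw [stateAt_of_lt f s hp1 (not_le.1 h)]
  have h2 : ∀ τ, ∫ m, ∫ y, φ ((τ, m), y) ∂jumpLaw c μ ∂μ =
      if u + τ ≤ t then ∫ m, value c μ f t F (f s (u + τ) m) (u + τ) ∂μ else F s := by
    intro τ
    by_cases h : u + τ ≤ t <;> simp [hφ, h, value]
  rw [h1, integral_prod _ (Integrable.of_bound hφm.aestronglyMeasurable C
    (Filter.Eventually.of_forall hφC)), integral_prod]
  · simp only [h2]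
    rw [integral_expMeasure_ite hc hut (φ := fun v => ∫ m, value c μ f t F (f s v m) v ∂μ) (C := C)]
    · exact (hV.stronglyMeasurable.integral_prod_right').measurable
    · intro v
      have := norm_integral_le_of_norm_le_const (μ := μ)
        (f := fun m => value c μ f t F (f s v m) v)
        (Filter.Eventually.of_forall fun m => abs_value_le hc hC _ _)
      simpa using this
  · refine Integrable.of_bound
      (hφm.stronglyMeasurable.integral_prod_right').aestronglyMeasurable C
      (Filter.Eventually.of_forall fun p => ?_)
    have := norm_integral_le_of_norm_le_const (μ := jumpLaw c μ) (f := fun y => φ (p, y))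
      (Filter.Eventually.of_forall fun y => hφC _)
    simpa using this

end Jump

/-! ### Real analysis -/

/-- Plays the role of Gronwall's lemma for renewal inequalities: the a priori bound improves to q ^
n times itself. It is applied with q = 1 - exp(-ct), which bounds the probability of a jump between
`u` and `t`. -/
theorem le_zero_of_contraction {ι : Type*} {Z : ι → ℝ} {C q : ℝ} (hq0 : 0 ≤ q) (hq1 : q < 1)
    (hC : ∀ i, Z i ≤ C) (h : ∀ ε, 0 ≤ ε → (∀ i, Z i ≤ ε) → ∀ i, Z i ≤ q * ε) (i : ι) :
    Z i ≤ 0 := by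
  have hn : ∀ n : ℕ, ∀ i, Z i ≤ q ^ n * max C 0 := by
    intro n
    induction n with
    | zero => simpa using fun i => Or.inl (hC i)
    | succ n ih =>
      intro i
      rw [pow_succ', mul_assoc]
      exact h _ (by positivity) ih i
  have hlim : Filter.Tendsto (fun n : ℕ => q ^ n * max C 0) Filter.atTop (nhds (0 * max C 0)) :=
    (tendsto_pow_atTop_nhds_zero_of_lt_one hq0 hq1).mul_const _
  rw [zero_mul] at hlim
  exact ge_of_tendsto' hlim fun n => hn n i

theorem intervalIntegrable_of_abs_le {g : ℝ → ℝ} (hg : Measurable g) {C : ℝ} (hC : ∀ v, |g v| ≤ C)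
    (a b : ℝ) : IntervalIntegrable g volume a b :=
  (intervalIntegrable_const (c := C)).mono_fun' hg.aestronglyMeasurable
    (Filter.Eventually.of_forall hC)

theorem intervalIntegrable_exp_mul {g : ℝ → ℝ} (hg : Measurable g) {C : ℝ} (hC : ∀ v, |g v| ≤ C)
    (c u a b : ℝ) :
    IntervalIntegrable (fun v => c * Real.exp (-(c * (v - u))) * g v) volume a b :=
  (intervalIntegrable_of_abs_le hg hC a b).continuousOn_mul (by fun_prop)

/-- The hypothesis on V says V' = c(V - g) almost everywhere, with V(t) = a. Hence (exp(-cv) V²)' =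
c exp(-cv)(V² - 2Vg), and the claim is the integral of this from u to t. As g is only measurable,
absolute continuity replaces differentiability. -/
theorem exp_mul_sq_add_integral {c a t C : ℝ} {g V : ℝ → ℝ} (hg : Measurable g)
    (hC : ∀ v, |g v| ≤ C) {u : ℝ} (hut : u ≤ t)
    (hV : ∀ v ∈ Set.Icc u t, V v = Real.exp (-(c * (t - v))) * a +
      ∫ w in v..t, c * Real.exp (-(c * (w - v))) * g w) :
    Real.exp (-(c * (t - u))) * a ^ 2 +
      ∫ v in u..t, c * Real.exp (-(c * (v - u))) * (2 * V v * g v - V v ^ 2) = V u ^ 2 := by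
  set φ : ℝ → ℝ := fun w => c * Real.exp (-(c * w)) * g w with hφ
  have hφi : ∀ x y, IntervalIntegrable φ volume x y := fun x y =>
    (intervalIntegrable_of_abs_le hg hC x y).continuousOn_mul (by fun_prop)
  -- `Y` is exp(-cv) V(v) on [u, t], written as a constant minus a primitive.
  set Y : ℝ → ℝ := fun v =>
    (Real.exp (-(c * t)) * a + ∫ w in u..t, φ w) - ∫ w in u..v, φ w with hY
  have hVY : ∀ v ∈ Set.Icc u t, V v = Real.exp (c * v) * Y v := by
    intro v hv
    have h1 : ∫ w in v..t, c * Real.exp (-(c * (w - v))) * g w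
        = Real.exp (c * v) * ∫ w in v..t, φ w := by
      rw [← intervalIntegral.integral_const_mul]
      congr 1
      funext w
      simp only [hφ]
      rw [show -(c * (w - v)) = c * v + -(c * w) by ring, Real.exp_add]
      ring
    have h2 := intervalIntegral.integral_add_adjacent_intervals (hφi u v) (hφi v t)
    rw [hV v hv, h1, show -(c * (t - v)) = c * v + -(c * t) by ring, Real.exp_add]
    simp only [hY]
    rw [← h2]
    ring
  have hYt : Y t = Real.exp (-(c * t)) * a := by simp [hY]
  have hYac : AbsolutelyContinuousOnInterval Y u t :=
    (ContDiffOn.absolutelyContinuousOnInterval (by fun_prop)).fun_sub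
      ((hφi u t).absolutelyContinuousOnInterval_intervalIntegral Set.left_mem_uIcc)
  have hEac : AbsolutelyContinuousOnInterval (fun v => Real.exp (c * v)) u t :=
    ContDiffOn.absolutelyContinuousOnInterval (by fun_prop)
  have hH := ((hEac.fun_mul hYac).fun_mul hYac).integral_deriv_eq_sub
  have hd : ∫ v in u..t, c * Real.exp (-(c * (v - u))) * (2 * V v * g v - V v ^ 2) =
      ∫ v in u..t, -Real.exp (c * u) * deriv (fun v => Real.exp (c * v) * Y v * Y v) v := by
    refine intervalIntegral.integral_congr_ae ?_
    filter_upwards [(hφi u t).ae_hasDerivAt_integral] with v hv hvm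
    have hvI : v ∈ Set.uIcc u t := Set.uIoc_subset_uIcc hvm
    have hYd : HasDerivAt Y (-φ v) v := by
      simpa using (hv hvI u Set.left_mem_uIcc).const_sub
        (Real.exp (-(c * t)) * a + ∫ w in u..t, φ w)
    have hEd : HasDerivAt (fun v => Real.exp (c * v)) (Real.exp (c * v) * (c * 1)) v :=
      ((hasDerivAt_id v).const_mul c).exp
    rw [((hEd.fun_mul hYd).fun_mul hYd).deriv, hVY v (by rwa [Set.uIcc_of_le hut] at hvI),
      show -(c * (v - u)) = c * u + -(c * v) by ring, Real.exp_add]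
    simp only [hφ]
    have he : Real.exp (c * v) * Real.exp (-(c * v)) = 1 := by rw [← Real.exp_add]; simp
    linear_combination (-c * Real.exp (c * u) * Real.exp (c * v) * Y v ^ 2) * he
  have he1 : Real.exp (c * t) * Real.exp (-(c * t)) = 1 := by rw [← Real.exp_add]; simp
  rw [hd, intervalIntegral.integral_const_mul, hH, hYt, hVY u ⟨le_rfl, hut⟩,
    show -(c * (t - u)) = c * u + -(c * t) by ring, Real.exp_add]
  linear_combination (-Real.exp (c * u) * Real.exp (-(c * t)) * a ^ 2) * he1

/-- Shows that d exp(κ(t - u)) solves the renewal equation in which a jump multiplies by 1 + κ/c,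
while an error ε shrinks by the probability of a jump. -/
theorem integral_exp_discrepancy {c κ : ℝ} (hc : c ≠ 0) (d ε t u : ℝ) :
    ∫ v in u..t, c * Real.exp (-(c * (v - u))) * ((1 + κ / c) * d * Real.exp (κ * (t - v)) + ε) =
      d * (Real.exp (κ * (t - u)) - Real.exp (-(c * (t - u)))) +
        ε * (1 - Real.exp (-(c * (t - u)))) := by
  have hderiv : ∀ v ∈ Set.uIcc u t, HasDerivAt
      (fun v => -(Real.exp (-(c * (v - u))) * (d * Real.exp (κ * (t - v)) + ε)))
      (c * Real.exp (-(c * (v - u))) * ((1 + κ / c) * d * Real.exp (κ * (t - v)) + ε)) v := by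
    intro v _
    have h1 : HasDerivAt (fun v => Real.exp (-(c * (v - u))))
        (Real.exp (-(c * (v - u))) * (-(c * 1))) v :=
      ((((hasDerivAt_id v).sub_const u).const_mul c).neg).exp
    have h2 : HasDerivAt (fun v => Real.exp (κ * (t - v)))
        (Real.exp (κ * (t - v)) * (κ * (-1))) v :=
      (((hasDerivAt_id v).const_sub t).const_mul κ).exp
    refine (h1.mul ((h2.const_mul d).add_const ε)).neg.congr_deriv ?_
    field_simp
    ring
  rw [intervalIntegral.integral_eq_sub_of_hasDerivAt hderiv
    (Continuous.intervalIntegrable (by fun_prop) _ _)]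
  simp
  ring

/-- The variance bound B, the integral of c (δ exp(κ(t - v)))² over [u, t], reproduces itself: at
the first jump one squared increment is added to the remaining bound. An error ε shrinks as before.
-/
theorem integral_exp_variance {κ : ℝ} (hκ : κ ≠ 0) (c δ ε t u : ℝ) :
    ∫ v in u..t, c * Real.exp (-(c * (v - u))) * ((δ * Real.exp (κ * (t - v))) ^ 2 +
        c * δ ^ 2 * (Real.exp (2 * κ * (t - v)) - 1) / (2 * κ) + ε) =
      c * δ ^ 2 * (Real.exp (2 * κ * (t - u)) - 1) / (2 * κ) +
        ε * (1 - Real.exp (-(c * (t - u)))) := by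
  have hderiv : ∀ v ∈ Set.uIcc u t, HasDerivAt
      (fun v => -(Real.exp (-(c * (v - u))) *
        (c * δ ^ 2 / (2 * κ) * (Real.exp (2 * κ * (t - v)) - 1) + ε)))
      (c * Real.exp (-(c * (v - u))) * ((δ * Real.exp (κ * (t - v))) ^ 2 +
        c * δ ^ 2 * (Real.exp (2 * κ * (t - v)) - 1) / (2 * κ) + ε)) v := by
    intro v _
    have h1 : HasDerivAt (fun v => Real.exp (-(c * (v - u))))
        (Real.exp (-(c * (v - u))) * (-(c * 1))) v :=
      ((((hasDerivAt_id v).sub_const u).const_mul c).neg).exp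
    have h2 : HasDerivAt (fun v => Real.exp (2 * κ * (t - v)))
        (Real.exp (2 * κ * (t - v)) * (2 * κ * (-1))) v :=
      (((hasDerivAt_id v).const_sub t).const_mul (2 * κ)).exp
    refine (h1.mul (((h2.sub_const 1).const_mul (c * δ ^ 2 / (2 * κ))).add_const ε)).neg.congr_deriv
      ?_
    have h3 : Real.exp (κ * (t - v)) ^ 2 = Real.exp (2 * κ * (t - v)) := by
      rw [← Real.exp_nat_mul]; congr 1; push_cast; ring
    rw [mul_pow, h3]
    field_simp
    ring
  rw [intervalIntegral.integral_eq_sub_of_hasDerivAt hderiv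
    (Continuous.intervalIntegrable (by fun_prop) _ _)]
  simp
  ring

/-! ### Fluctuations of the jump process -/

section Jump

variable {S M : Type*} [MeasurableSpace S] [MeasurableSpace M] {c : ℝ} {μ : Measure M}
  [IsProbabilityMeasure μ]

theorem measurable_value_step (hc : 0 < c) {f : S → ℝ → M → S}
    (hf : Measurable fun p : S × ℝ × M => f p.1 p.2.1 p.2.2) (t : ℝ) {F : S → ℝ}
    (hF : Measurable F) (s : S) :
    Measurable fun p : ℝ × M => value c μ f t F (f s p.1 p.2) p.1 :=
  (measurable_value (μ := μ) hc hf t hF).comp (f := fun p : ℝ × M => (f s p.1 p.2, p.1))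
    ((hf.comp (f := fun p : ℝ × M => (s, p)) (by fun_prop)).prodMk measurable_fst)

theorem integrable_value_step (hc : 0 < c) {f : S → ℝ → M → S}
    (hf : Measurable fun p : S × ℝ × M => f p.1 p.2.1 p.2.2) (t : ℝ) {F : S → ℝ}
    (hF : Measurable F) {C : ℝ} (hC : ∀ s, |F s| ≤ C) (s : S) (v : ℝ) :
    Integrable (fun m => value c μ f t F (f s v m) v) μ :=
  Integrable.of_bound ((measurable_value_step hc hf t hF s).comp
    (f := fun m : M => (v, m)) (by fun_prop)).aestronglyMeasurable C
    (Filter.Eventually.of_forall fun m => abs_value_le hc hC _ _)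

theorem measurable_integral_value_step (hc : 0 < c) {f : S → ℝ → M → S}
    (hf : Measurable fun p : S × ℝ × M => f p.1 p.2.1 p.2.2) (t : ℝ) {F : S → ℝ}
    (hF : Measurable F) (s : S) :
    Measurable fun v => ∫ m, value c μ f t F (f s v m) v ∂μ :=
  ((measurable_value_step hc hf t hF s).stronglyMeasurable.integral_prod_right').measurable

omit [MeasurableSpace S] in
theorem abs_integral_value_step_le (hc : 0 < c) {f : S → ℝ → M → S} {t : ℝ} {F : S → ℝ}
    {C : ℝ} (hC : ∀ s, |F s| ≤ C) (s : S) (v : ℝ) :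
    |∫ m, value c μ f t F (f s v m) v ∂μ| ≤ C := by
  have := norm_integral_le_of_norm_le_const (μ := μ)
    (f := fun m => value c μ f t F (f s v m) v)
    (Filter.Eventually.of_forall fun m => abs_value_le hc hC _ _)
  simpa using this

/-- If a jump multiplies the distance of two states by at most `1 + κ / c` on average, then the
expectations at time `t` depend on the starting point in a Lipschitz way. -/
theorem abs_value_sub_le (hc : 0 < c) {f : S → ℝ → M → S}
    (hf : Measurable fun p : S × ℝ × M => f p.1 p.2.1 p.2.2) {t : ℝ} (ht : 0 ≤ t) {F : S → ℝ}
    (hF : Measurable F) {C : ℝ} (hC : ∀ s, |F s| ≤ C) {κ : ℝ} {d : S → S → ℝ}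
    (hd : ∀ s s', 0 ≤ d s s') (hFd : ∀ s s', |F s - F s'| ≤ d s s')
    (hstep : ∀ s s' v, ∃ e : M → ℝ, Integrable e μ ∧ (∀ m, d (f s v m) (f s' v m) ≤ e m) ∧
      ∫ m, e m ∂μ ≤ (1 + κ / c) * d s s')
    (s s' : S) {u : ℝ} (hu : u ∈ Set.Icc 0 t) :
    |value c μ f t F s u - value c μ f t F s' u| ≤ d s s' * Real.exp (κ * (t - u)) := by
  set V := value c μ f t F with hV
  set Z : S × S × Set.Icc 0 t → ℝ := fun p =>
    |V p.1 p.2.2 - V p.2.1 p.2.2| - d p.1 p.2.1 * Real.exp (κ * (t - p.2.2)) with hZ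
  suffices h : Z (s, s', ⟨u, hu⟩) ≤ 0 by
    simp only [hZ] at h
    linarith
  refine le_zero_of_contraction (C := 2 * C) (q := 1 - Real.exp (-(c * t))) ?_ ?_ ?_ ?_ _
  · have : Real.exp (-(c * t)) ≤ 1 := Real.exp_le_one_iff.2 (by nlinarith)
    linarith
  · linarith [Real.exp_pos (-(c * t))]
  · rintro ⟨s, s', u, hu⟩
    have h1 := abs_sub (V s u) (V s' u)
    have h2 : |V s u| ≤ C := abs_value_le hc hC s u
    have h3 : |V s' u| ≤ C := abs_value_le hc hC s' u
    have h4 := mul_nonneg (hd s s') (Real.exp_pos (κ * (t - u))).le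
    simp only [hZ]
    linarith
  · rintro ε hε hall ⟨s, s', u, hu0, hut⟩
    have hgm := fun s => measurable_integral_value_step (μ := μ) hc hf t hF s
    have hgC := fun s v => abs_integral_value_step_le (μ := μ) (f := f) (t := t) hc hC s v
    have hgi := fun s => intervalIntegrable_exp_mul (hgm s) (hgC s) c u u t
    -- This subtraction is the coupling: both copies make the same first jump.
    have hdiff : V s u - V s' u = Real.exp (-(c * (t - u))) * (F s - F s') +
        ∫ v in u..t, c * Real.exp (-(c * (v - u))) * ((∫ m, V (f s v m) v ∂μ) -
          ∫ m, V (f s' v m) v ∂μ) := by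
      simp only [mul_sub (c * Real.exp _)]
      rw [intervalIntegral.integral_sub (hgi s) (hgi s'), hV,
        value_eq hc hf hF hC s hu0 hut, value_eq hc hf hF hC s' hu0 hut]
      ring
    have hg : ∀ v ∈ Set.Icc u t, |(∫ m, V (f s v m) v ∂μ) - ∫ m, V (f s' v m) v ∂μ| ≤
        (1 + κ / c) * d s s' * Real.exp (κ * (t - v)) + ε := by
      intro v hv
      -- The majorant `e` is integrated in place of the distance, which is not assumed measurable in
      -- the mark.
      obtain ⟨e, hei, hde, hle⟩ := hstep s s' v
      rw [← integral_sub (integrable_value_step hc hf t hF hC s v)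
        (integrable_value_step hc hf t hF hC s' v)]
      have h1 := norm_integral_le_of_norm_le (μ := μ)
        (f := fun m => V (f s v m) v - V (f s' v m) v)
        (g := fun m => e m * Real.exp (κ * (t - v)) + ε)
        ((hei.mul_const _).add (integrable_const ε)) (Filter.Eventually.of_forall fun m => by
          have h2 := hall (f s v m, f s' v m, ⟨v, hu0.trans hv.1, hv.2⟩)
          simp only [hZ] at h2
          have h3 := mul_le_mul_of_nonneg_right (hde m) (Real.exp_pos (κ * (t - v))).le
          rw [Real.norm_eq_abs]
          linarith)
      rw [integral_add (hei.mul_const _) (integrable_const ε), integral_mul_const] at h1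
      have h3 := mul_le_mul_of_nonneg_right hle (Real.exp_pos (κ * (t - v))).le
      simp only [integral_const, probReal_univ, one_smul, Real.norm_eq_abs] at h1
      linarith
    have hint : |∫ v in u..t, c * Real.exp (-(c * (v - u))) * ((∫ m, V (f s v m) v ∂μ) -
          ∫ m, V (f s' v m) v ∂μ)| ≤ ∫ v in u..t, c * Real.exp (-(c * (v - u))) *
            ((1 + κ / c) * d s s' * Real.exp (κ * (t - v)) + ε) := by
      refine intervalIntegral.norm_integral_le_of_norm_le (E := ℝ) (μ := volume)
        (f := fun v => c * Real.exp (-(c * (v - u))) *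
          ((∫ m, V (f s v m) v ∂μ) - ∫ m, V (f s' v m) v ∂μ)) (g := fun v => c *
        Real.exp (-(c * (v - u))) * ((1 + κ / c) * d s s' * Real.exp (κ * (t - v)) + ε)) hut (Filter.Eventually.of_forall
        fun v hv => ?_) (Continuous.intervalIntegrable (by fun_prop) _ _)
      rw [Real.norm_eq_abs, abs_mul, abs_of_pos (by positivity)]
      exact mul_le_mul_of_nonneg_left (hg v ⟨hv.1.le, hv.2⟩) (by positivity)
    rw [integral_exp_discrepancy hc.ne'] at hint
    have h5 : |Real.exp (-(c * (t - u))) * (F s - F s')| ≤ Real.exp (-(c * (t - u))) * d s s' := by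
      rw [abs_mul, abs_of_pos (Real.exp_pos _)]
      exact mul_le_mul_of_nonneg_left (hFd s s') (Real.exp_pos _).le
    have h6 : Real.exp (-(c * t)) ≤ Real.exp (-(c * (t - u))) :=
      Real.exp_le_exp.2 (by nlinarith)
    have h7 := mul_le_mul_of_nonneg_left h6 hε
    have h8 := abs_add_le (Real.exp (-(c * (t - u))) * (F s - F s'))
      (∫ v in u..t, c * Real.exp (-(c * (v - u))) * ((∫ m, V (f s v m) v ∂μ) -
          ∫ m, V (f s' v m) v ∂μ))
    simp only [hZ]
    rw [hdiff]
    linarith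

/-- A bound for the variance at time `t`, given the effect of one additional jump. -/
theorem value_sq_sub_sq_value_le (hc : 0 < c) {f : S → ℝ → M → S}
    (hf : Measurable fun p : S × ℝ × M => f p.1 p.2.1 p.2.2) {t : ℝ} (ht : 0 ≤ t) {F : S → ℝ}
    (hF : Measurable F) {C : ℝ} (hC : ∀ s, |F s| ≤ C) {κ δ : ℝ} (hκ : 0 < κ)
    (hjump : ∀ s m, ∀ v ∈ Set.Icc 0 t,
      |value c μ f t F (f s v m) v - value c μ f t F s v| ≤ δ * Real.exp (κ * (t - v)))
    (s : S) {u : ℝ} (hu : u ∈ Set.Icc 0 t) :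
    value c μ f t (fun s => F s ^ 2) s u - value c μ f t F s u ^ 2 ≤
      c * δ ^ 2 * (Real.exp (2 * κ * (t - u)) - 1) / (2 * κ) := by
  set V := value c μ f t F with hV
  set Q := value c μ f t (fun s => F s ^ 2) with hQ
  set B : ℝ → ℝ := fun u => c * δ ^ 2 * (Real.exp (2 * κ * (t - u)) - 1) / (2 * κ) with hB
  have hF2 : Measurable fun s => F s ^ 2 := hF.pow_const 2
  have hC2 : ∀ s, |F s ^ 2| ≤ C ^ 2 := fun s => by
    rw [abs_pow]
    exact pow_le_pow_left₀ (abs_nonneg _) (hC s) 2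
  have hB0 : ∀ u ∈ Set.Icc 0 t, 0 ≤ B u := by
    intro u hu
    have : 1 ≤ Real.exp (2 * κ * (t - u)) :=
      Real.one_le_exp (by have := hu.2; have : 0 ≤ t - u := by linarith
                          positivity)
    have : 0 ≤ Real.exp (2 * κ * (t - u)) - 1 := by linarith
    simp only [hB]
    positivity
  set Z : S × Set.Icc 0 t → ℝ := fun p => Q p.1 p.2 - V p.1 p.2 ^ 2 - B p.2 with hZ
  suffices h : Z (s, ⟨u, hu⟩) ≤ 0 by
    simp only [hZ] at h
    linarith
  refine le_zero_of_contraction (C := C ^ 2) (q := 1 - Real.exp (-(c * t))) ?_ ?_ ?_ ?_ _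
  · have : Real.exp (-(c * t)) ≤ 1 := Real.exp_le_one_iff.2 (by nlinarith)
    linarith
  · linarith [Real.exp_pos (-(c * t))]
  · rintro ⟨s, u, hu⟩
    have h2 : |Q s u| ≤ C ^ 2 := abs_value_le hc hC2 s u
    have h3 := le_abs_self (Q s u)
    have h4 := hB0 u hu
    have h5 := sq_nonneg (V s u)
    simp only [hZ]
    linarith
  · rintro ε hε hall ⟨s, u, hu0, hut⟩
    set g : ℝ → ℝ := fun v => ∫ m, V (f s v m) v ∂μ with hg
    have hgm : Measurable g := measurable_integral_value_step (μ := μ) hc hf t hF s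
    have hgC : ∀ v, |g v| ≤ C := fun v => abs_integral_value_step_le hc hC s v
    have hVm : Measurable fun v => V s v :=
      (measurable_value (μ := μ) hc hf t hF).comp (f := fun v => (s, v)) (by fun_prop)
    have hVC : ∀ v, |V s v| ≤ C := fun v => abs_value_le hc hC s v
    have hC0 : 0 ≤ C := (abs_nonneg _).trans (hVC 0)
    -- With W the value after the jump and V before it, (W - V)² ≤ (δ exp(κ(t - v)))² gives W² ≤ 2VW
    -- - V² plus that square; then average over the mark.
    have hG : ∀ v ∈ Set.Icc u t, ∫ m, Q (f s v m) v ∂μ ≤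
        (2 * V s v * g v - V s v ^ 2) + ((δ * Real.exp (κ * (t - v))) ^ 2 + B v + ε) := by
      intro v hv
      have hv' : v ∈ Set.Icc 0 t := ⟨hu0.trans hv.1, hv.2⟩
      have hi := integrable_value_step (μ := μ) hc hf t hF hC s v
      have hb : ∀ m, Q (f s v m) v ≤ 2 * V s v * V (f s v m) v +
          (-V s v ^ 2 + ((δ * Real.exp (κ * (t - v))) ^ 2 + B v + ε)) := by
        intro m
        have h1 := hall (f s v m, ⟨v, hv'⟩)
        have h2 := sq_le_sq' (abs_le.1 (hjump s m v hv')).1 (abs_le.1 (hjump s m v hv')).2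
        simp only [hZ] at h1
        nlinarith
      refine (integral_mono (integrable_value_step (μ := μ) hc hf t hF2 hC2 s v)
        ((hi.const_mul (2 * V s v)).add (integrable_const _)) hb).trans_eq ?_
      rw [integral_add' (hi.const_mul _) (integrable_const _), integral_const_mul]
      simp only [integral_const, probReal_univ, one_smul, hg]
      ring
    -- With the no-jump term of `Q`, the terms 2Vg - V² add up to exactly V(s, u)², so only squared
    -- increments and the later variance remain.
    have hid := exp_mul_sq_add_integral (c := c) (a := F s) (V := V s) hgm hgC hut
      (fun v hv => value_eq hc hf hF hC s (hu0.trans hv.1) hv.2)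
    have hi1 : IntervalIntegrable (fun v => c * Real.exp (-(c * (v - u))) *
        (2 * V s v * g v - V s v ^ 2)) volume u t := by
      refine intervalIntegrable_exp_mul (g := fun v => 2 * V s v * g v - V s v ^ 2)
        (by fun_prop) (C := 3 * C ^ 2) (fun v => ?_) c u u t
      have h1 := abs_le.1 (hVC v)
      have h2 := abs_le.1 (hgC v)
      rw [abs_le]
      constructor <;> nlinarith
    have hi2 : IntervalIntegrable (fun v => c * Real.exp (-(c * (v - u))) *
        ((δ * Real.exp (κ * (t - v))) ^ 2 + B v + ε)) volume u t :=
      Continuous.intervalIntegrable (by fun_prop) _ _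
    have hint : ∫ v in u..t, c * Real.exp (-(c * (v - u))) * ∫ m, Q (f s v m) v ∂μ ≤
        (∫ v in u..t, c * Real.exp (-(c * (v - u))) * (2 * V s v * g v - V s v ^ 2)) +
        ∫ v in u..t, c * Real.exp (-(c * (v - u))) *
          ((δ * Real.exp (κ * (t - v))) ^ 2 + B v + ε) := by
      rw [← intervalIntegral.integral_add hi1 hi2]
      refine intervalIntegral.integral_mono_on hut (intervalIntegrable_exp_mul
        (measurable_integral_value_step (μ := μ) hc hf t hF2 s)
        (fun v => abs_integral_value_step_le hc hC2 s v) c u u t) (hi1.add hi2) fun v hv => ?_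
      rw [← mul_add]
      exact mul_le_mul_of_nonneg_left (hG v hv) (by positivity)
    rw [integral_exp_variance hκ.ne'] at hint
    have h6 : Real.exp (-(c * t)) ≤ Real.exp (-(c * (t - u))) :=
      Real.exp_le_exp.2 (by nlinarith)
    have h7 := mul_le_mul_of_nonneg_left h6 hε
    have hQe := value_eq (μ := μ) hc hf hF2 hC2 s hu0 hut
    rw [← hQ] at hQe
    simp only [hZ]
    rw [hQe]
    simp only [hB]
    linarith

end Jump

/-! ### Variance bounds for functions of independent variables -/

section Variance

/-- A function of oscillation at most `b` stays within `b` of its mean. -/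
theorem integral_sq_sub_sq_integral_le_of_abs_sub_le {α : Type*} [MeasurableSpace α]
    {μ : Measure α} [IsProbabilityMeasure μ] {h : α → ℝ} (hm : Measurable h) {C : ℝ}
    (hC : ∀ x, |h x| ≤ C) {b : ℝ} (hb : ∀ x x', |h x - h x'| ≤ b) :
    ∫ x, h x ^ 2 ∂μ - (∫ x, h x ∂μ) ^ 2 ≤ b ^ 2 := by
  have hi : Integrable h μ :=
    Integrable.of_bound hm.aestronglyMeasurable C (Filter.Eventually.of_forall hC)
  have hi2 : Integrable (fun x => h x ^ 2) μ :=
    Integrable.of_bound (hm.pow_const 2).aestronglyMeasurable (C ^ 2)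
      (Filter.Eventually.of_forall fun x => by
        rw [Real.norm_eq_abs, abs_pow]; exact pow_le_pow_left₀ (abs_nonneg _) (hC x) 2)
  set a := ∫ x, h x ∂μ with ha
  have hxa : ∀ x, |h x - a| ≤ b := by
    intro x
    have h1 : h x - a = ∫ y, (h x - h y) ∂μ := by
      rw [integral_sub (integrable_const _) hi]; simp [ha]
    rw [h1]
    simpa using norm_integral_le_of_norm_le_const (μ := μ) (f := fun y => h x - h y)
      (Filter.Eventually.of_forall fun y => hb x y)
  have h2 : ∫ x, h x ^ 2 ∂μ ≤ ∫ x, (2 * a * h x + (b ^ 2 - a ^ 2)) ∂μ := by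
    refine integral_mono hi2 ((hi.const_mul _).add (integrable_const _)) fun x => ?_
    have := sq_le_sq' (abs_le.1 (hxa x)).1 (abs_le.1 (hxa x)).2
    simp only
    nlinarith
  rw [integral_add (hi.const_mul _) (integrable_const _), integral_const_mul, ← ha] at h2
  simp only [integral_const, probReal_univ, one_smul] at h2
  linarith

/-- Law of total variance: `h₁` bounds the conditional variances, `h₂` the variance of the
conditional expectation. -/
theorem integral_prod_sq_sub_sq_le {α β : Type*} [MeasurableSpace α] [MeasurableSpace β]
    {μ : Measure α} {ν : Measure β} [IsProbabilityMeasure μ] [IsProbabilityMeasure ν]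
    {f : α × β → ℝ} (hf : Measurable f) {C : ℝ} (hC : ∀ z, |f z| ≤ C) {b₁ b₂ : ℝ}
    (h₁ : ∀ x, ∫ y, f (x, y) ^ 2 ∂ν - (∫ y, f (x, y) ∂ν) ^ 2 ≤ b₁)
    (h₂ : ∫ x, (∫ y, f (x, y) ∂ν) ^ 2 ∂μ - (∫ x, ∫ y, f (x, y) ∂ν ∂μ) ^ 2 ≤ b₂) :
    ∫ z, f z ^ 2 ∂μ.prod ν - (∫ z, f z ∂μ.prod ν) ^ 2 ≤ b₁ + b₂ := by
  have hi : Integrable f (μ.prod ν) :=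
    Integrable.of_bound hf.aestronglyMeasurable C (Filter.Eventually.of_forall hC)
  have hi2 : Integrable (fun z => f z ^ 2) (μ.prod ν) :=
    Integrable.of_bound (hf.pow_const 2).aestronglyMeasurable (C ^ 2)
      (Filter.Eventually.of_forall fun x => by
        rw [Real.norm_eq_abs, abs_pow]; exact pow_le_pow_left₀ (abs_nonneg _) (hC x) 2)
  have hhm : Measurable fun x => ∫ y, f (x, y) ∂ν :=
    (hf.stronglyMeasurable.integral_prod_right').measurable
  have hhi : Integrable (fun x => (∫ y, f (x, y) ∂ν) ^ 2) μ :=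
    Integrable.of_bound (hhm.pow_const 2).aestronglyMeasurable (C ^ 2)
      (Filter.Eventually.of_forall fun x => by
        rw [Real.norm_eq_abs, abs_pow]
        refine pow_le_pow_left₀ (abs_nonneg _) ?_ 2
        simpa using norm_integral_le_of_norm_le_const (μ := ν) (f := fun y => f (x, y))
          (Filter.Eventually.of_forall fun y => hC _))
  rw [integral_prod _ hi, integral_prod _ hi2]
  have h3 : ∫ x, ∫ y, f (x, y) ^ 2 ∂ν ∂μ ≤ ∫ x, ((∫ y, f (x, y) ∂ν) ^ 2 + b₁) ∂μ :=
    integral_mono hi2.integral_prod_left (hhi.add (integrable_const _)) fun x => by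
      have := h₁ x
      simp only
      linarith
  rw [integral_add hhi (integrable_const _)] at h3
  simp only [integral_const, probReal_univ, one_smul] at h3
  linarith

/-- An Efron–Stein type inequality for functions with bounded differences. -/
theorem integral_pi_sq_sub_sq_le {α : Type*} [MeasurableSpace α] {n : ℕ} (μ : Fin n → Measure α)
    [∀ i, IsProbabilityMeasure (μ i)] {f : (Fin n → α) → ℝ} (hf : Measurable f) {C : ℝ}
    (hC : ∀ y, |f y| ≤ C) {b : ℝ}
    (hb : ∀ i y y', (∀ j, j ≠ i → y j = y' j) → |f y - f y'| ≤ b) :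
    ∫ y, f y ^ 2 ∂Measure.pi μ - (∫ y, f y ∂Measure.pi μ) ^ 2 ≤ n * b ^ 2 := by
  induction n with
  | zero =>
    have := integral_sq_sub_sq_integral_le_of_abs_sub_le (μ := Measure.pi μ) hf hC (b := 0)
      fun x x' => by rw [Subsingleton.elim x x']; simp
    simpa using this
  | succ n ih =>
    have hmp := (measurePreserving_piFinSuccAbove μ 0).symm
    set e := (MeasurableEquiv.piFinSuccAbove (fun _ : Fin (n + 1) => α) 0).symm with he
    have he0 : ∀ x y, e (x, y) 0 = x := fun x y => by
      simp [he, MeasurableEquiv.piFinSuccAbove]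
    have hes : ∀ x y j, e (x, y) (Fin.succ j) = y j := fun x y j => by
      simp [he, MeasurableEquiv.piFinSuccAbove]
    rw [← hmp.integral_comp' (g := fun y => f y ^ 2), ← hmp.integral_comp' (g := f)]
    have hfe : Measurable fun z => f (e z) := hf.comp e.measurable
    -- Condition on coordinate 0: the others fall to the induction hypothesis, and averaging over
    -- them keeps the oscillation in coordinate 0 at most `b`.
    refine (integral_prod_sq_sub_sq_le hfe (fun z => hC _) (b₁ := n * b ^ 2) (b₂ := b ^ 2)
      (fun x => ?_) ?_).trans_eq (by push_cast; ring)
    · refine ih (fun j => μ (Fin.succAbove 0 j)) (f := fun y => f (e (x, y)))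
        (hfe.comp (f := fun y => (x, y)) (by fun_prop)) (fun y => hC _) fun i y y' hyy => ?_
      refine hb i.succ _ _ fun j hj => ?_
      refine Fin.cases ?_ (fun j hj => ?_) j hj
      · intro _; rw [he0, he0]
      · rw [hes, hes]
        exact hyy j fun h => hj (by rw [h])
    · refine integral_sq_sub_sq_integral_le_of_abs_sub_le (C := C)
        (hfe.stronglyMeasurable.integral_prod_right').measurable (fun x => ?_) fun x x' => ?_
      · simpa using norm_integral_le_of_norm_le_const
          (μ := Measure.pi fun j => μ (Fin.succAbove 0 j)) (f := fun y => f (e (x, y)))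
          (Filter.Eventually.of_forall fun y => hC _)
      · have hi : ∀ x, Integrable (fun y => f (e (x, y)))
            (Measure.pi fun j => μ (Fin.succAbove 0 j)) := fun x =>
          Integrable.of_bound (hfe.comp (f := fun y => (x, y)) (by fun_prop)).aestronglyMeasurable
            C (Filter.Eventually.of_forall fun y => hC _)
        rw [← integral_sub (hi x) (hi x')]
        simpa using norm_integral_le_of_norm_le_const
          (μ := Measure.pi fun j => μ (Fin.succAbove 0 j))
          (f := fun y => f (e (x, y)) - f (e (x', y)))
          (Filter.Eventually.of_forall fun y => hb 0 _ _ fun j hj => by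
            refine Fin.cases (fun h => absurd rfl h) (fun j _ => ?_) j hj
            rw [hes, hes])

/-- The variances of F + G and F - G are nonnegative, so twice the absolute covariance is at most
the sum of the two variances. -/
theorem abs_integral_mul_sub_le {Ω : Type*} [MeasurableSpace Ω] {P : Measure Ω}
    [IsProbabilityMeasure P] {F G : Ω → ℝ} (hF : Integrable F P) (hG : Integrable G P)
    (hFF : Integrable (fun ω => F ω ^ 2) P) (hGG : Integrable (fun ω => G ω ^ 2) P)
    (hFG : Integrable (fun ω => F ω * G ω) P) {b : ℝ}
    (hFb : ∫ ω, F ω ^ 2 ∂P - (∫ ω, F ω ∂P) ^ 2 ≤ b)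
    (hGb : ∫ ω, G ω ^ 2 ∂P - (∫ ω, G ω ∂P) ^ 2 ≤ b) :
    |∫ ω, F ω * G ω ∂P - (∫ ω, F ω ∂P) * ∫ ω, G ω ∂P| ≤ b := by
  have key : ∀ σ : ℝ, σ ^ 2 = 1 →
      0 ≤ ∫ ω, F ω ^ 2 ∂P - (∫ ω, F ω ∂P) ^ 2 + (∫ ω, G ω ^ 2 ∂P - (∫ ω, G ω ∂P) ^ 2) +
        2 * σ * (∫ ω, F ω * G ω ∂P - (∫ ω, F ω ∂P) * ∫ ω, G ω ∂P) := by
    intro σ hσ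
    set a := ∫ ω, F ω ∂P
    set a' := ∫ ω, G ω ∂P
    have h0 : 0 ≤ ∫ ω, (F ω + σ * G ω - (a + σ * a')) ^ 2 ∂P :=
      integral_nonneg fun ω => sq_nonneg _
    have h1 : ∀ ω, (F ω + σ * G ω - (a + σ * a')) ^ 2 =
        ((F ω ^ 2 + G ω ^ 2) + 2 * σ * (F ω * G ω)) +
          ((-2 * (a + σ * a')) * F ω + (-2 * σ * (a + σ * a')) * G ω) + (a + σ * a') ^ 2 := by
      intro ω
      linear_combination (G ω ^ 2) * hσ
    simp only [h1] at h0
    have i1 : Integrable (fun ω => F ω ^ 2 + G ω ^ 2) P := hFF.add hGG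
    have i2 : Integrable (fun ω => 2 * σ * (F ω * G ω)) P := hFG.const_mul _
    have i3 : Integrable (fun ω => F ω ^ 2 + G ω ^ 2 + 2 * σ * (F ω * G ω)) P := i1.add i2
    have i4 : Integrable (fun ω => -2 * (a + σ * a') * F ω) P := hF.const_mul _
    have i5 : Integrable (fun ω => -2 * σ * (a + σ * a') * G ω) P := hG.const_mul _
    have i6 : Integrable (fun ω => -2 * (a + σ * a') * F ω + -2 * σ * (a + σ * a') * G ω) P :=
      i4.add i5
    have i7 : Integrable (fun ω => F ω ^ 2 + G ω ^ 2 + 2 * σ * (F ω * G ω) +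
        (-2 * (a + σ * a') * F ω + -2 * σ * (a + σ * a') * G ω)) P := i3.add i6
    rw [integral_add i7 (integrable_const _), integral_add i3 i6, integral_add i1 i2,
      integral_add hFF hGG, integral_add i4 i5] at h0
    simp only [integral_const_mul, integral_const, probReal_univ, one_smul] at h0
    refine h0.trans_eq ?_
    linear_combination (-a' ^ 2) * hσ
  have h1 := key 1 (by norm_num)
  have h2 := key (-1) (by norm_num)
  rw [abs_le]
  constructor <;> linarith

end Variance

/-! ### The sampled servers -/

variable {N : ℕ}

theorem isProbabilityMeasure_uniformOn_card {D : ℕ} (hDN : D ≤ N) :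
    IsProbabilityMeasure (uniformOn {s : Finset (Fin N) | s.card = D}) := by
  refine isProbabilityMeasure_uniformOn (Set.toFinite _) ?_
  obtain ⟨s, -, hs⟩ := Finset.exists_subset_card_eq (s := (Finset.univ : Finset (Fin N)))
    (n := D) (by simpa using hDN)
  exact ⟨s, hs⟩

/-- A server belongs to a uniformly random set of `D` servers with probability `D / N`. -/
theorem uniformOn_card_real_mem {D : ℕ} (hD : 1 ≤ D) (hDN : D ≤ N) (i : Fin N) :
    (uniformOn {s : Finset (Fin N) | s.card = D}).real {s | i ∈ s} = D / N := by
  classical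
  have h1 : {s : Finset (Fin N) | s.card = D} =
      ((Finset.powersetCard D Finset.univ : Finset (Finset (Fin N))) : Set (Finset (Fin N))) := by
    ext s; simp [Finset.mem_powersetCard]
  have h2 : {s : Finset (Fin N) | i ∈ s} =
      ((Finset.univ.filter fun s : Finset (Fin N) => i ∈ s : Finset (Finset (Fin N))) :
        Set (Finset (Fin N))) := by
    ext s; simp
  have h3 : (Finset.powersetCard D Finset.univ ∩ Finset.univ.filter fun s : Finset (Fin N) => i ∈ s)
      = (Finset.powersetCard (D - 1) (Finset.univ.erase i)).image (insert i) := by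
    ext s
    simp only [Finset.mem_inter, Finset.mem_powersetCard, Finset.subset_univ, true_and,
      Finset.mem_filter, Finset.mem_univ, Finset.mem_image]
    constructor
    · rintro ⟨hs, hi⟩
      refine ⟨s.erase i, ⟨Finset.erase_subset_erase _ (Finset.subset_univ _), ?_⟩,
        Finset.insert_erase hi⟩
      rw [Finset.card_erase_of_mem hi, hs]
    · rintro ⟨a, ⟨ha, hac⟩, rfl⟩
      have hia : i ∉ a := fun h => by simpa using ha h
      refine ⟨?_, Finset.mem_insert_self _ _⟩
      rw [Finset.card_insert_of_notMem hia, hac]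
      omega
  have h4 : (Finset.powersetCard D Finset.univ ∩ Finset.univ.filter
      fun s : Finset (Fin N) => i ∈ s).card = (N - 1).choose (D - 1) := by
    rw [h3, Finset.card_image_of_injOn, Finset.card_powersetCard, Finset.card_erase_of_mem
      (Finset.mem_univ i), Finset.card_univ, Fintype.card_fin]
    intro a ha b hb hab
    have hia : ∀ a ∈ Finset.powersetCard (D - 1) (Finset.univ.erase i), i ∉ a := fun a ha h => by
      simpa using (Finset.mem_powersetCard.1 ha).1 h
    rw [← Finset.erase_insert (hia a ha), ← Finset.erase_insert (hia b hb)]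
    exact congrArg (fun x => x.erase i) hab
  rw [measureReal_def, h1, h2, uniformOn_apply_finset, h4, Finset.card_powersetCard,
    Finset.card_univ, Fintype.card_fin, ENNReal.toReal_div, ENNReal.toReal_natCast,
    ENNReal.toReal_natCast]
  have hc : (0 : ℝ) < N.choose D := by exact_mod_cast Nat.choose_pos hDN
  have hN : (0 : ℝ) < N := by exact_mod_cast lt_of_lt_of_le hD hDN
  rw [div_eq_div_iff hc.ne' hN.ne']
  obtain ⟨n, rfl⟩ : ∃ n, N = n + 1 := ⟨N - 1, by omega⟩
  obtain ⟨k, rfl⟩ : ∃ k, D = k + 1 := ⟨D - 1, by omega⟩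
  have := Nat.add_one_mul_choose_eq n k
  simp only [Nat.add_sub_cancel]
  have h5 : ((n + 1 : ℕ) : ℝ) * (n.choose k : ℝ) = ((n + 1).choose (k + 1) : ℝ) * ((k + 1 : ℕ) : ℝ) :=
    by exact_mod_cast this
  linarith

/-- The law of a mark. -/
noncomputable def markLaw (N D : ℕ) (ν : Measure ℝ) : Measure (Mark N) :=
  (uniformOn {s : Finset (Fin N) | s.card = D}).prod
    ((uniformOn (Set.univ : Set (Equiv.Perm (Fin N)))).prod ν)

instance : MeasurableSingletonClass (Equiv.Perm (Fin N)) := ⟨fun _ => trivial⟩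

theorem isProbabilityMeasure_uniformOn_perm :
    IsProbabilityMeasure (uniformOn (Set.univ : Set (Equiv.Perm (Fin N)))) :=
  isProbabilityMeasure_uniformOn Set.finite_univ Set.univ_nonempty

theorem isProbabilityMeasure_markLaw {D : ℕ} (hDN : D ≤ N) (ν : Measure ℝ)
    [IsProbabilityMeasure ν] : IsProbabilityMeasure (markLaw N D ν) := by
  have := isProbabilityMeasure_uniformOn_card hDN
  have := isProbabilityMeasure_uniformOn_perm (N := N)
  unfold markLaw
  infer_instance

theorem integral_markLaw_mem {D : ℕ} (hD : 1 ≤ D) (hDN : D ≤ N) (ν : Measure ℝ)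
    [IsProbabilityMeasure ν] (i : Fin N) :
    Integrable ({m : Mark N | i ∈ m.1}.indicator fun _ => (1 : ℝ)) (markLaw N D ν) ∧
      ∫ m, {m : Mark N | i ∈ m.1}.indicator (fun _ => (1 : ℝ)) m ∂markLaw N D ν = D / N := by
  have := isProbabilityMeasure_uniformOn_card hDN
  have := isProbabilityMeasure_uniformOn_perm (N := N)
  have := isProbabilityMeasure_markLaw hDN ν
  have hm : MeasurableSet {m : Mark N | i ∈ m.1} :=
    (measurableSet_mem_finset i).preimage measurable_fst
  refine ⟨(integrable_const 1).indicator hm, ?_⟩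
  rw [integral_indicator hm, setIntegral_const, smul_eq_mul, mul_one,
    ← uniformOn_card_real_mem hD hDN i]
  have hp : {m : Mark N | i ∈ m.1} = {s : Finset (Fin N) | i ∈ s} ×ˢ Set.univ := by
    ext m; simp
  rw [hp, markLaw, measureReal_def, Measure.prod_prod, measure_univ, mul_one, measureReal_def]

/-- One arrival multiplies the discrepancy by at most `1 + D / N` on average. -/
theorem exists_discrepancy_step_bound (disc : ServiceDiscipline) {D : ℕ} (hD : 1 ≤ D)
    (hDN : D ≤ N) (ν : Measure ℝ) [IsProbabilityMeasure ν] (s s' : State N) (v : ℝ) :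
    ∃ e : Mark N → ℝ, Integrable e (markLaw N D ν) ∧
      (∀ m, discrepancy (step disc s v m) (step disc s' v m) ≤ e m) ∧
      ∫ m, e m ∂markLaw N D ν ≤ (1 + (D : ℝ) / N) * discrepancy s s' := by
  classical
  have := isProbabilityMeasure_markLaw hDN ν
  set A := Finset.univ.filter fun i => s i ≠ s' i with hA
  have hint := fun i => integral_markLaw_mem hD hDN ν (i := i)
  have hsum : Integrable (fun m => ∑ i ∈ A, {m : Mark N | i ∈ m.1}.indicator (fun _ => (1 : ℝ)) m)
      (markLaw N D ν) := integrable_finsetSum _ fun i _ => (hint i).1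
  -- Union bound: the indicator that the sample meets `A` is at most the number of sampled servers
  -- in `A`, whose mean is |A| D/N.
  refine ⟨fun m => discrepancy s s' +
    (∑ i ∈ A, {m : Mark N | i ∈ m.1}.indicator (fun _ => (1 : ℝ)) m) / N,
    (integrable_const _).add (hsum.div_const _), fun m => ?_, ?_⟩
  · refine (discrepancy_step_le disc s s' v m).trans ?_
    refine add_le_add le_rfl (div_le_div_of_nonneg_right ?_ (Nat.cast_nonneg N))
    have h0 : ∀ i ∈ A, 0 ≤ {m : Mark N | i ∈ m.1}.indicator (fun _ => (1 : ℝ)) m := fun i _ =>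
      Set.indicator_nonneg (fun _ _ => zero_le_one) m
    split_ifs with h
    · obtain ⟨i, hi, hne⟩ := h
      refine le_trans ?_ (Finset.single_le_sum h0 (show i ∈ A by simp [hA, hne]))
      rw [Set.indicator_of_mem (by exact hi)]
    · exact Finset.sum_nonneg h0
  · rw [integral_add (integrable_const _) (hsum.div_const _), integral_div,
      integral_finsetSum _ fun i _ => (hint i).1]
    simp only [fun i => (hint i).2, integral_const, probReal_univ, one_smul, Finset.sum_const,
      nsmul_eq_mul]
    refine le_of_eq ?_
    have : discrepancy s s' = A.card / N := by simp only [discrepancy, hA]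
    rw [this]
    ring

/-! ### The system as a jump process -/

/-- The state at time `0`. -/
def initialState (ξ : Fin N → ℕ) (y : Fin N → ServerData) : State N :=
  fun i => ((y i).1, List.ofFn fun j : Fin (ξ i) => ((0 : ℝ), (y i).2 j))

theorem measurable_initialState (ξ : Fin N → ℕ) : Measurable (initialState ξ) := by
  refine measurable_pi_lambda _ fun i => Measurable.prodMk (by fun_prop) ?_
  exact (measurable_ofFn (ξ i)).comp
    (f := fun y : Fin N → ServerData => fun j : Fin (ξ i) => ((0 : ℝ), (y i).2 j)) (by fun_prop)

theorem jumpTime_zero_eq (ω : Outcome N) (n : ℕ) : jumpTime 0 ω.1 n = arrivalTime ω n := by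
  simp [jumpTime, arrivalTime]

/-- Identifies the system with the abstract jump process; the internal randomness rides along
unchanged in the state. -/
theorem jumpState_step_eq (disc : ServiceDiscipline) (ξ : Fin N → ℕ) (ω : Outcome N) (n : ℕ) :
    jumpState (step disc) (initialState ξ ω.2) 0 ω.1 n =
      fun i => ((ω.2 i).1, history disc ξ ω n i) := by
  induction n with
  | zero => rfl
  | succ n ih =>
    rw [jumpState, ih, jumpTime_zero_eq]
    funext i
    simp only [step, history]

theorem empiricalAt_eq (disc : ServiceDiscipline) (ξ : Fin N → ℕ) (t : ℝ) (k : ℕ) (ω : Outcome N) :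
    empiricalAt disc ξ t k ω =
      observe disc t k (stateAt (step disc) t (initialState ξ ω.2) 0 ω.1) := by
  have h : Set.ncard {n | jumpTime 0 ω.1 n ≤ t} = arrivalCount ω t := by
    simp only [jumpTime_zero_eq, arrivalCount]
  rw [stateAt, h, jumpState_step_eq]
  rfl

theorem measurable_empiricalAt (disc : ServiceDiscipline) (ξ : Fin N → ℕ) (t : ℝ) (k : ℕ) :
    Measurable (empiricalAt disc ξ t k) := by
  have : empiricalAt disc ξ t k = fun ω =>
      observe disc t k (stateAt (step disc) t (initialState ξ ω.2) 0 ω.1) :=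
    funext (empiricalAt_eq disc ξ t k)
  rw [this]
  refine (measurable_observe disc t k).comp ((measurable_stateAt (measurable_step disc) t).comp
    (f := fun ω : Outcome N => (initialState ξ ω.2, (0 : ℝ), ω.1)) ?_)
  exact ((measurable_initialState ξ).comp measurable_snd).prodMk (by fun_prop)

theorem abs_observe_le_one (disc : ServiceDiscipline) (t : ℝ) (k : ℕ) (s : State N) :
    |observe disc t k s| ≤ 1 := by
  rw [abs_of_nonneg (observe_nonneg disc t k s)]
  exact observe_le_one disc t k s

theorem abs_empiricalAt_le_one (disc : ServiceDiscipline) (ξ : Fin N → ℕ) (t : ℝ) (k : ℕ)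
    (ω : Outcome N) : |empiricalAt disc ξ t k ω| ≤ 1 := by
  rw [empiricalAt_eq]
  exact abs_observe_le_one _ _ _ _

instance isProbabilityMeasure_serverLaw (ρ : Fin N → Measure (ℕ → ℝ))
    [∀ i, IsProbabilityMeasure (ρ i)] (i : Fin N) :
    IsProbabilityMeasure ((volume.restrict (Set.Icc (0 : ℝ) 1)).prod (ρ i)) := by
  have : IsProbabilityMeasure (volume.restrict (Set.Icc (0 : ℝ) 1)) := ⟨by simp⟩
  infer_instance

theorem inputLaw_eq (N D : ℕ) (lam : ℝ) (ν : Measure ℝ) (ρ : Fin N → Measure (ℕ → ℝ)) :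
    inputLaw N D lam ν ρ = (jumpLaw (lam * N) (markLaw N D ν)).prod
      (Measure.pi fun i => (volume.restrict (Set.Icc (0 : ℝ) 1)).prod (ρ i)) := rfl

theorem isProbabilityMeasure_inputLaw {D : ℕ} {lam : ℝ} (hc : 0 < lam * N) (hDN : D ≤ N)
    (ν : Measure ℝ) [IsProbabilityMeasure ν] (ρ : Fin N → Measure (ℕ → ℝ))
    [∀ i, IsProbabilityMeasure (ρ i)] : IsProbabilityMeasure (inputLaw N D lam ν ρ) := by
  have := isProbabilityMeasure_markLaw hDN ν
  have := isProbabilityMeasure_jumpLaw (μ := markLaw N D ν) hc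
  rw [inputLaw_eq]
  infer_instance

/-- Condition on the server data. The arrivals give the second term (rate λN, δ = 1/N, κ = λD), the
N independent servers the first (oscillation exp(λDt)/N each). -/
theorem empiricalAt_variance_le (disc : ServiceDiscipline) {D : ℕ} (hD : 1 ≤ D) (hDN : D ≤ N)
    {lam : ℝ} (hlam : 0 < lam) (ν : Measure ℝ) [IsProbabilityMeasure ν]
    (ρ : Fin N → Measure (ℕ → ℝ)) [∀ i, IsProbabilityMeasure (ρ i)] (ξ : Fin N → ℕ) {t : ℝ}
    (ht : 0 ≤ t) (k : ℕ) :
    ∫ ω, empiricalAt disc ξ t k ω ^ 2 ∂inputLaw N D lam ν ρ -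
        (∫ ω, empiricalAt disc ξ t k ω ∂inputLaw N D lam ν ρ) ^ 2 ≤
      (Real.exp (2 * (lam * D) * t) + (Real.exp (2 * (lam * D) * t) - 1) / (2 * D)) / N := by
  have hN : (0 : ℝ) < N := by exact_mod_cast lt_of_lt_of_le hD hDN
  have hD' : (0 : ℝ) < D := by exact_mod_cast hD
  have hc : 0 < lam * N := by positivity
  have hκ : 0 < lam * D := by positivity
  have := isProbabilityMeasure_markLaw hDN ν
  have := isProbabilityMeasure_jumpLaw (μ := markLaw N D ν) hc
  set F : State N → ℝ := observe disc t k with hF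
  have hFm : Measurable F := measurable_observe disc t k
  have hFC : ∀ s, |F s| ≤ 1 := abs_observe_le_one disc t k
  have hf := measurable_step (N := N) disc
  set V := value (lam * N) (markLaw N D ν) (step disc) t F with hV
  have hlip : ∀ s s' : State N, ∀ u ∈ Set.Icc 0 t,
      |V s u - V s' u| ≤ discrepancy s s' * Real.exp (lam * D * (t - u)) := by
    intro s s' u hu
    refine abs_value_sub_le hc hf ht hFm hFC discrepancy_nonneg
      (abs_observe_sub_le disc t k) (fun s s' v => ?_) s s' hu
    -- Here κ/c = λD/(λN) = D/N, the mean growth per arrival.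
    rw [mul_div_mul_left _ _ hlam.ne']
    exact exists_discrepancy_step_bound disc hD hDN ν s s' v
  have hjump : ∀ s m, ∀ v ∈ Set.Icc 0 t,
      |V (step disc s v m) v - V s v| ≤ 1 / N * Real.exp (lam * D * (t - v)) := by
    intro s m v hv
    rw [abs_sub_comm]
    exact (hlip s _ v hv).trans
      (mul_le_mul_of_nonneg_right (discrepancy_step_self_le disc s v m) (Real.exp_pos _).le)
  have h0 : (0 : ℝ) ∈ Set.Icc 0 t := ⟨le_rfl, ht⟩
  set Q := Measure.pi fun i => (volume.restrict (Set.Icc (0 : ℝ) 1)).prod (ρ i) with hQ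
  -- The factors are swapped so that the inner integral runs over the arrivals, with the server data
  -- fixed.
  set f : (Fin N → ServerData) × (ℕ → Arrival N) → ℝ := fun z =>
    empiricalAt disc ξ t k z.swap with hfdef
  have hfm : Measurable f := (measurable_empiricalAt disc ξ t k).comp measurable_swap
  have hinner : ∀ y, ∫ x, f (y, x) ∂jumpLaw (lam * N) (markLaw N D ν) = V (initialState ξ y) 0 := by
    intro y
    simp only [hfdef, empiricalAt_eq, hV, value, hF]
    rfl
  have hinner2 : ∀ y, ∫ x, f (y, x) ^ 2 ∂jumpLaw (lam * N) (markLaw N D ν) =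
      value (lam * N) (markLaw N D ν) (step disc) t (fun s => F s ^ 2) (initialState ξ y) 0 := by
    intro y
    simp only [hfdef, empiricalAt_eq, value, hF]
    rfl
  have hmain := integral_prod_sq_sub_sq_le (μ := Q) (ν := jumpLaw (lam * N) (markLaw N D ν)) hfm
    (fun z => abs_empiricalAt_le_one disc ξ t k _)
    (b₁ := lam * N * (1 / N) ^ 2 * (Real.exp (2 * (lam * D) * (t - 0)) - 1) / (2 * (lam * D)))
    (b₂ := N * (1 / N * Real.exp (lam * D * (t - 0))) ^ 2)
    (fun y => by
      rw [hinner, hinner2]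
      exact value_sq_sub_sq_value_le hc hf ht hFm hFC hκ hjump _ h0)
    (by
      simp only [hinner]
      refine integral_pi_sq_sub_sq_le _ (C := 1) ?_ (fun y => abs_value_le hc hFC _ _)
        fun i y y' hyy => ?_
      · exact (measurable_value hc hf t hFm).comp
          (f := fun y => (initialState ξ y, (0 : ℝ)))
          ((measurable_initialState ξ).prodMk measurable_const)
      · refine (hlip _ _ 0 h0).trans (mul_le_mul_of_nonneg_right ?_ (Real.exp_pos _).le)
        refine discrepancy_le_of_forall_eq i fun j hj => ?_
        simp only [initialState, hyy j hj])
  have hs1 : ∫ z, f z ∂Q.prod (jumpLaw (lam * N) (markLaw N D ν)) =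
      ∫ ω, empiricalAt disc ξ t k ω ∂inputLaw N D lam ν ρ := by
    rw [inputLaw_eq]
    exact integral_prod_swap (μ := jumpLaw (lam * N) (markLaw N D ν)) (ν := Q)
      (fun ω : Outcome N => empiricalAt disc ξ t k ω)
  have hs2 : ∫ z, f z ^ 2 ∂Q.prod (jumpLaw (lam * N) (markLaw N D ν)) =
      ∫ ω, empiricalAt disc ξ t k ω ^ 2 ∂inputLaw N D lam ν ρ := by
    rw [inputLaw_eq]
    exact integral_prod_swap (μ := jumpLaw (lam * N) (markLaw N D ν)) (ν := Q)
      (fun ω : Outcome N => empiricalAt disc ξ t k ω ^ 2)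
  rw [hs1, hs2] at hmain
  refine hmain.trans_eq ?_
  have he : Real.exp (lam * D * t) ^ 2 = Real.exp (2 * (lam * D) * t) := by
    rw [← Real.exp_nat_mul]; congr 1; push_cast; ring
  rw [sub_zero, mul_pow, he]
  field_simp
  ring

/-- With y = exp(2λDt), the left side is at most y + (y - 1)/2 = 1 + (3/2)(y - 1), since D ≥ 1; then
3/2 ≤ (3/2)^D and 2 ≤ 2^D. Equality holds for D = 1. -/
theorem variance_bound_le {D : ℕ} (hD : 1 ≤ D) {lam t : ℝ} (hlam : 0 < lam) (ht : 0 ≤ t) :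
    Real.exp (2 * (lam * D) * t) + (Real.exp (2 * (lam * D) * t) - 1) / (2 * D) ≤
      1 + (3 / 2 : ℝ) ^ D * (Real.exp ((2 : ℝ) ^ D * lam * D * t) - 1) := by
  have hD' : (1 : ℝ) ≤ D := by exact_mod_cast hD
  set y := Real.exp (2 * (lam * D) * t) with hy
  have hy1 : 1 ≤ y := Real.one_le_exp (by positivity)
  have h2 : (2 : ℝ) ≤ 2 ^ D := le_self_pow₀ (by norm_num) (by omega)
  have h3 : (3 / 2 : ℝ) ≤ (3 / 2) ^ D := le_self_pow₀ (by norm_num) (by omega)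
  have h4 : y ≤ Real.exp ((2 : ℝ) ^ D * lam * D * t) := by
    refine Real.exp_le_exp.2 ?_
    have : 0 ≤ lam * D * t := by positivity
    nlinarith
  have h5 : (y - 1) / (2 * D) ≤ (y - 1) / 2 :=
    div_le_div_of_nonneg_left (by linarith) (by norm_num) (by linarith)
  have h6 : (3 / 2 : ℝ) * (y - 1) ≤
      (3 / 2 : ℝ) ^ D * (Real.exp ((2 : ℝ) ^ D * lam * D * t) - 1) :=
    mul_le_mul h3 (by linarith) (by linarith) (by positivity)
  linarith

end PowerOfD

/-! ### The covariance bound -/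

theorem corollary2p2 (D : ℕ) (hD : 1 ≤ D) (lam : ℝ) (hlam0 : 0 < lam) (hlam1 : lam < 1)
    (ν : Measure ℝ) [IsProbabilityMeasure ν] (hν : ∀ᵐ s ∂ν, 0 < s)
    (disc : PowerOfD.ServiceDiscipline) (t : ℝ) (ht : 0 ≤ t) (k l : ℕ) :
    ∃ N₀ : ℕ, D ≤ N₀ ∧ ∀ N : ℕ, N₀ ≤ N →
      ∀ (ξ : Fin N → ℕ) (ρ : Fin N → Measure (ℕ → ℝ)) [∀ i, IsProbabilityMeasure (ρ i)],
        (∀ i, ∀ᵐ r ∂ρ i, ∀ j, 0 < r j) →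
        Integrable (PowerOfD.empiricalAt disc ξ t k) (PowerOfD.inputLaw N D lam ν ρ) ∧
        Integrable (PowerOfD.empiricalAt disc ξ t l) (PowerOfD.inputLaw N D lam ν ρ) ∧
        Integrable (fun ω => PowerOfD.empiricalAt disc ξ t k ω * PowerOfD.empiricalAt disc ξ t l ω)
          (PowerOfD.inputLaw N D lam ν ρ) ∧
        |(∫ ω, PowerOfD.empiricalAt disc ξ t k ω * PowerOfD.empiricalAt disc ξ t l ω
              ∂PowerOfD.inputLaw N D lam ν ρ)
            - (∫ ω, PowerOfD.empiricalAt disc ξ t k ω ∂PowerOfD.inputLaw N D lam ν ρ)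
              * (∫ ω, PowerOfD.empiricalAt disc ξ t l ω ∂PowerOfD.inputLaw N D lam ν ρ)|
          ≤ (1 + (3 / 2 : ℝ) ^ D * (Real.exp ((2 : ℝ) ^ D * lam * D * t) - 1)) / N := by
  -- The variance bound holds for every N ≥ D, so N₀ = D serves for all `t`, `k`, `l`.
  refine ⟨D, le_rfl, fun N hDN ξ ρ _ _ => ?_⟩
  have hN : (0 : ℝ) < N := by exact_mod_cast lt_of_lt_of_le hD hDN
  have := PowerOfD.isProbabilityMeasure_inputLaw (mul_pos hlam0 hN) hDN ν ρ
  have hm := fun k => PowerOfD.measurable_empiricalAt disc ξ t k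
  have hb := PowerOfD.abs_empiricalAt_le_one disc ξ t
  have hint : ∀ k, Integrable (PowerOfD.empiricalAt disc ξ t k) (PowerOfD.inputLaw N D lam ν ρ) :=
    fun k => Integrable.of_bound (hm k).aestronglyMeasurable 1
      (Filter.Eventually.of_forall (hb k))
  have hmul : ∀ k l, Integrable
      (fun ω => PowerOfD.empiricalAt disc ξ t k ω * PowerOfD.empiricalAt disc ξ t l ω)
      (PowerOfD.inputLaw N D lam ν ρ) := fun k l =>
    Integrable.of_bound ((hm k).mul (hm l)).aestronglyMeasurable 1
      (Filter.Eventually.of_forall fun ω => by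
        rw [Real.norm_eq_abs, abs_mul]
        exact mul_le_one₀ (hb k ω) (abs_nonneg _) (hb l ω))
  have hsq : ∀ k, Integrable (fun ω => PowerOfD.empiricalAt disc ξ t k ω ^ 2)
      (PowerOfD.inputLaw N D lam ν ρ) := fun k => by simpa only [sq] using hmul k k
  have hvar := fun k => (PowerOfD.empiricalAt_variance_le disc hD hDN hlam0 ν ρ ξ ht k).trans
    (div_le_div_of_nonneg_right (PowerOfD.variance_bound_le hD hlam0 ht) hN.le)
  exact ⟨hint k, hint l, hmul k l, PowerOfD.abs_integral_mul_sub_le (hint k) (hint l) (hsq k)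
    (hsq l) (hmul k l) (hvar k) (hvar l)⟩
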